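/- **Proposition 4.3 (pullback).** Let $G$ be an exponential solvable Lie group with Lie algebra $\mathfrak g$, i.e. $G$ is a (real, finite-dimensional) simply connected Lie group, $\mathfrak g$ is solvable, and $\exp:\mathfrak g\to G$ is a diffeomorphism. Let $\mathfrak n=[\mathfrak g,\mathfrak g]$. Let $A_1,\dots,A_n$ be a coexponential basis to $\mathfrak n$ in $\mathfrak g$, i.e. a basis of a subspace complementary to $\mathfrak n$ such that $t_1A_1+\dots+t_nA_n+X\mapsto \exp(t_1A_1)\cdots\exp(t_nA_n)\exp(X)$ ($t_i\in\mathbb R$, $X\in\mathfrak n$) is a diffeomorphism of $\mathfrak g$ onto $G$, and let $N_1,\dots,N_m$ be a Malcev basis of $\mathfrak n$, i.e. a basis such that $\operatorname{span}\{N_j,\dots,N_m\}$ is a Lie subalgebra for every $j$. Let $$\Phi:\mathfrak g\to G,\qquad \Phi\Big(\sum_{i=1}^n t_iA_i+\sum_{j=1}^m s_jN_j\Big)=\exp(t_1A_1)\cdots\exp(t_nA_n)\exp(s_1N_1)\cdots\exp(s_mN_m).$$ Write $\mathfrak D(G)$ for the algebra of left-invariant linear differential operators on $G$ (acting on real-valued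 smooth functions), $\iota(g)=g^{-1}$ for the inversion of $G$ and $(\iota_*L)f=\big(L(f\circ\iota)\big)\circ\iota$. Let $\mathfrak D(\mathfrak g)$ be the algebra of differential operators with constant coefficients on the vector space $\mathfrak g$, let $$\mathcal O_M^{\exp}(\mathfrak g)=\Big\{f\in C^\infty(\mathfrak g):\ \forall P\in\mathfrak D(\mathfrak g)\ \exists\lambda>0:\ \sup_{X\in\mathfrak g}|(Pf)(X)|\,e^{-\lambda|X|_{\mathfrak g}}<\infty\Big\},$$ where $|\cdot|_{\mathfrak g}$ is a norm on $\mathfrak g$, and let $\mathfrak D_{\exp}(\mathfrak g)$ be the algebra of operators on $C^\infty(\mathfrak g)$ generated by $\mathfrak D(\mathfrak g)$ and the multiplications by functions in $\mathcal O_M^{\exp}(\mathfrak g)$. Then $\Phi$ is a diffeomorphism, and for every $L\in\mathfrak D(G)$ the pullbacks $\Phi^*(L):\varphi\mapsto \big(L(\varphi\circ\Phi^{-1})\big)\circ\Phi$ and $\Phi^*(\iota_*L)$ belong to $\mathfrak D_{\exp}(\mathfrak g)$. In particular each of them is a finite sum $\sum_k f_kP_k$ with $f_k\in\mathcal O_M^{\exp}(\mathfrak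 g)$ and $P_k\in\mathfrak D(\mathfrak g)$, i.e. a differential operator whose coefficients are smooth and, together with all their derivatives, exponentially bounded. -/

import Mathlib

open scoped Manifold ContDiff

namespace ExpSolvable

instance leInftyMinSmoothnessReal : ENat.LEInfty (minSmoothness ℝ 3) :=
  ⟨by rw [minSmoothness_of_isRCLikeNormedField]; exact ENat.LEInfty.out⟩

/-! ### Linear differential operators on algebras of smooth functions -/

section DifferentialOperators

/-- Differential operators of order at most `k` on a commutative algebra `A`, in the sense of
Grothendieck: the commutator with every multiplication operator is a differential operator of
order at most `k - 1`, and those of order `0` commute with all multiplication operators.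
For `A = C^∞(M)`, with `M` a smooth manifold, these are the usual linear partial differential
operators of order at most `k` with smooth coefficients. -/
def IsDiffOpOfOrderLE {A : Type*} [CommRing A] [Algebra ℝ A] :
    ℕ → Module.End ℝ A → Prop
  | 0, D => ∀ a : A, D * LinearMap.mulLeft ℝ a - LinearMap.mulLeft ℝ a * D = 0
  | k + 1, D => ∀ a : A,
      IsDiffOpOfOrderLE k (D * LinearMap.mulLeft ℝ a - LinearMap.mulLeft ℝ a * D)

/-- Linear differential operators (of some finite order) on `A`. -/
def IsDiffOp {A : Type*} [CommRing A] [Algebra ℝ A] (D : Module.End ℝ A) : Prop :=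
  ∃ k : ℕ, IsDiffOpOfOrderLE k D

variable {E : Type*} [NormedAddCommGroup E] [NormedSpace ℝ E]
  {M : Type*} [TopologicalSpace M] [ChartedSpace E M]
  {F : Type*} [NormedAddCommGroup F] [NormedSpace ℝ F]
  {N : Type*} [TopologicalSpace N] [ChartedSpace F N]

/-- The pullback `Ψ^* L : f ↦ (L (f ∘ Ψ⁻¹)) ∘ Ψ` of an operator `L` on `C^∞(N)` along a
diffeomorphism `Ψ : M → N`. -/
noncomputable def pullbackOp (Ψ : M ≃ₘ^∞⟮𝓘(ℝ, E), 𝓘(ℝ, F)⟯ N)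
    (L : Module.End ℝ C^∞⟮𝓘(ℝ, F), N; ℝ⟯) : Module.End ℝ C^∞⟮𝓘(ℝ, E), M; ℝ⟯ where
  toFun f := (L (f.comp Ψ.symm.toContMDiffMap)).comp Ψ.toContMDiffMap
  map_add' f g := by
    have h : (f + g).comp Ψ.symm.toContMDiffMap =
      f.comp Ψ.symm.toContMDiffMap + g.comp Ψ.symm.toContMDiffMap := rfl
    rw [h, map_add]; rfl
  map_smul' c f := by
    have h : (c • f).comp Ψ.symm.toContMDiffMap = c • f.comp Ψ.symm.toContMDiffMap := rfl
    rw [h, map_smul]; rfl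

/-- The pushforward `Ψ_* L : f ↦ (L (f ∘ Ψ)) ∘ Ψ⁻¹` of an operator `L` on `C^∞(M)` along a
diffeomorphism `Ψ : M → N`. -/
noncomputable def pushforwardOp (Ψ : M ≃ₘ^∞⟮𝓘(ℝ, E), 𝓘(ℝ, F)⟯ N)
    (L : Module.End ℝ C^∞⟮𝓘(ℝ, E), M; ℝ⟯) : Module.End ℝ C^∞⟮𝓘(ℝ, F), N; ℝ⟯ :=
  pullbackOp Ψ.symm L

end DifferentialOperators

/-! ### Differential operators with exponentially bounded coefficients on a vector space -/

section VectorSpace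

variable (V : Type*) [NormedAddCommGroup V] [NormedSpace ℝ V]

variable {V} in
/-- The directional derivative `∂_v` on `C^∞(V)`. -/
noncomputable def dirDeriv (v : V) : Module.End ℝ C^∞⟮𝓘(ℝ, V), V; ℝ⟯ where
  toFun f := ⟨fun x => fderiv ℝ f x v, by
    have hf : ContDiff ℝ ∞ f := f.contMDiff.contDiff
    exact ((hf.fderiv_right (m := ∞) (by simp)).clm_apply contDiff_const).contMDiff⟩
  map_add' f g := by
    have hf : ContDiff ℝ ∞ f := f.contMDiff.contDiff
    have hg : ContDiff ℝ ∞ g := g.contMDiff.contDiff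
    ext x
    change fderiv ℝ (fun y => f y + g y) x v = fderiv ℝ f x v + fderiv ℝ g x v
    rw [fderiv_fun_add (hf.differentiable (by simp) x) (hg.differentiable (by simp) x)]
    rfl
  map_smul' c f := by
    have hf : ContDiff ℝ ∞ f := f.contMDiff.contDiff
    ext x
    change fderiv ℝ (fun y => c • f y) x v = c • fderiv ℝ f x v
    rw [fderiv_fun_const_smul (hf.differentiable (by simp) x)]
    rfl

/-- `𝔇(V)`: the algebra of translation-invariant (that is, constant coefficient) differential
operators on `V`, generated by the directional derivatives. -/
noncomputable def constCoeffOps : Subalgebra ℝ (Module.End ℝ C^∞⟮𝓘(ℝ, V), V; ℝ⟯) :=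
  Algebra.adjoin ℝ (Set.range dirDeriv)

/-- `𝒪_M^exp(V)`: the smooth functions on `V` that are exponentially bounded together with all
their derivatives. -/
def expMultipliers : Set C^∞⟮𝓘(ℝ, V), V; ℝ⟯ :=
  {f | ∀ P ∈ constCoeffOps V, ∃ c : ℝ, 0 < c ∧
    BddAbove (Set.range fun x : V => |P f x| * Real.exp (-(c * ‖x‖)))}

/-- `𝔇_exp(V)`: the algebra of differential operators generated by (multiplication by) the
functions in `𝒪_M^exp(V)` and by `𝔇(V)`. -/
noncomputable def expDiffOps : Subalgebra ℝ (Module.End ℝ C^∞⟮𝓘(ℝ, V), V; ℝ⟯) :=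
  Algebra.adjoin ℝ (LinearMap.mulLeft ℝ '' expMultipliers V ∪ constCoeffOps V)

variable {V} in
/-- `P` is a finite sum `∑ f_k P_k` with `f_k ∈ 𝒪_M^exp(V)` and `P_k ∈ 𝔇(V)`. -/
def HasExpCoeffs (P : Module.End ℝ C^∞⟮𝓘(ℝ, V), V; ℝ⟯) : Prop :=
  ∃ (r : ℕ) (f : Fin r → C^∞⟮𝓘(ℝ, V), V; ℝ⟯) (Q : Fin r → Module.End ℝ C^∞⟮𝓘(ℝ, V), V; ℝ⟯),
    (∀ k, f k ∈ expMultipliers V) ∧ (∀ k, Q k ∈ constCoeffOps V) ∧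
      P = ∑ k, LinearMap.mulLeft ℝ (f k) * Q k

end VectorSpace

/-! ### Lie groups -/

section LieGroups

variable {E : Type*} [NormedAddCommGroup E] [NormedSpace ℝ E]
  {G : Type*} [TopologicalSpace G] [ChartedSpace E G] [Group G]

open Classical in
/-- The exponential map of a Lie group: `lieExp X = γ 1`, where `γ` is the one-parameter subgroup
generated by `X`, that is, the integral curve through `1` of the left-invariant vector field
with value `X` at `1`. (Left-invariant vector fields being complete, `γ` always exists, and it is
unique; the value `1` in the last branch is never taken.) -/
noncomputable def lieExp (X : GroupLieAlgebra 𝓘(ℝ, E) G) : G :=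
  if h : ∃ γ : ℝ → G, IsMIntegralCurve (I := 𝓘(ℝ, E)) γ (mulInvariantVectorField X) ∧ γ 0 = 1
  then h.choose 1 else 1

/-- The ordered product `exp (t₁ X₁) ⋯ exp (t_k X_k)`. -/
noncomputable def expProd {k : ℕ} (X : Fin k → GroupLieAlgebra 𝓘(ℝ, E) G) (t : Fin k → ℝ) : G :=
  (List.ofFn fun i => lieExp (t i • X i)).prod

variable [LieGroup 𝓘(ℝ, E) ∞ G]

variable (E G) in
/-- The inversion `ι : g ↦ g⁻¹` as a diffeomorphism of `G`. -/
def inversion : G ≃ₘ^∞⟮𝓘(ℝ, E), 𝓘(ℝ, E)⟯ G where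
  toEquiv := Equiv.inv G
  contMDiff_toFun := contMDiff_inv 𝓘(ℝ, E) ∞
  contMDiff_invFun := contMDiff_inv 𝓘(ℝ, E) ∞

/-- `L ∈ 𝔇(G)`: `L` is a differential operator on `C^∞(G)` that commutes with all left
translations `f ↦ f (g ·)`. -/
def IsLeftInvariantDiffOp (L : Module.End ℝ C^∞⟮𝓘(ℝ, E), G; ℝ⟯) : Prop :=
  IsDiffOp L ∧ ∀ (g : G) (f : C^∞⟮𝓘(ℝ, E), G; ℝ⟯),
    L (f.comp (smoothLeftMul 𝓘(ℝ, E) g)) = (L f).comp (smoothLeftMul 𝓘(ℝ, E) g)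

variable [FiniteDimensional ℝ E]

variable (E G) in
/-- `G` is an exponential solvable Lie group: it is simply connected, its Lie algebra is solvable
and `exp` is a diffeomorphism from the Lie algebra (whose underlying vector space is the model
space `E`) onto `G`. -/
structure IsExponentialSolvable : Prop where
  simplyConnected : SimplyConnectedSpace G
  solvable : LieAlgebra.IsSolvable (GroupLieAlgebra 𝓘(ℝ, E) G)
  exp_diffeo : ∃ Ψ : E ≃ₘ^∞⟮𝓘(ℝ, E), 𝓘(ℝ, E)⟯ G,
    ∀ X : GroupLieAlgebra 𝓘(ℝ, E) G, Ψ X = lieExp X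

variable (E G) in
/-- The derived algebra `𝔫 = [𝔤, 𝔤]`, as a subspace of `𝔤`. -/
noncomputable def derivedAlgebra : Submodule ℝ (GroupLieAlgebra 𝓘(ℝ, E) G) :=
  Submodule.span ℝ {Z | ∃ X Y : GroupLieAlgebra 𝓘(ℝ, E) G, ⁅X, Y⁆ = Z}

/-- `A₁, …, A_n` is a coexponential basis to `𝔫 = [𝔤, 𝔤]` in `𝔤`: a basis of a complement of `𝔫`
such that `t₁ A₁ + ⋯ + t_n A_n + X ↦ exp (t₁ A₁) ⋯ exp (t_n A_n) exp X` (with `X ∈ 𝔫`) is a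
diffeomorphism from `𝔤` onto `G`. -/
structure IsCoexponentialBasis {n : ℕ} (A : Fin n → GroupLieAlgebra 𝓘(ℝ, E) G) : Prop where
  linearIndependent : LinearIndependent ℝ A
  isCompl : IsCompl (Submodule.span ℝ (Set.range A)) (derivedAlgebra E G)
  diffeo : ∃ Ψ : E ≃ₘ^∞⟮𝓘(ℝ, E), 𝓘(ℝ, E)⟯ G, ∀ (t : Fin n → ℝ), ∀ X ∈ derivedAlgebra E G,
    Ψ ((∑ i, t i • A i) + X) = expProd A t * lieExp X

/-- `N₁, …, N_m` is a Malcev basis of `𝔫 = [𝔤, 𝔤]`: a basis such that each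
`span {N_j, …, N_m}` is a Lie subalgebra. -/
structure IsMalcevBasis {m : ℕ} (N : Fin m → GroupLieAlgebra 𝓘(ℝ, E) G) : Prop where
  linearIndependent : LinearIndependent ℝ N
  span_eq : Submodule.span ℝ (Set.range N) = derivedAlgebra E G
  lie_mem : ∀ j : Fin m, ∀ X ∈ Submodule.span ℝ (N '' Set.Ici j),
    ∀ Y ∈ Submodule.span ℝ (N '' Set.Ici j), ⁅X, Y⁆ ∈ Submodule.span ℝ (N '' Set.Ici j)

end LieGroups

end ExpSolvable

/-! The exponential map identifies `G` with the vector space `E` carrying a group law `μ` (`expLaw`)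
for which lines through `0` are one-parameter subgroups. Hence `-x` is the inverse of `x`, Ad(exp
tX) = exp(t ad X) (`adjointRep_smul`), and the Lie bracket is the differential of Ad
(`adjointDeriv_expLaw`).

Let `b` be the basis `(A, N)` and `f(z) = ∏ exp(z_k b_k)`, computed in `(E, μ)` (`coordProd`), so
that `Φ = exp ∘ f`. The algebraic input is that brackets of the tail `span {b_i, b_{i+1}, …}` lie in
the next tail (`lie_mem_tailSpan_succ`). In the range of `A` this holds because all brackets lie in
`[𝔤, 𝔤]`. In the range of `N` it holds because elements of `[𝔤, 𝔤]` are ad-nilpotent, which forces a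
subalgebra of codimension one to absorb brackets. It follows that the factors of a group element can
be split off uniquely one at a time, so `f` is bijective. Its left logarithmic derivative `J = f⁻¹
df`, whose columns are Ad(later factors)⁻¹ `b_k`, is unitriangular. So `f` is a diffeomorphism. The
entries of `J` are polynomials in those of exp(-z_k ad b_k), hence lie in `𝒪_M^exp`, and so do those
of `J⁻¹`, the adjugate of `J`.

In the coordinates `Φ`, an invariant operator satisfies `D f (x) = D (f ∘ m_x) (0)` with `m_x` a
translation, and at `0` it agrees with a constant coefficient operator by Hadamard's lemma. For left
translations `m_x'(y) = J(m_x y)⁻¹ J(y)`. So each derivative of `f ∘ m_x` produces vector fields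
with coefficients from `J⁻¹`, applied to `f` and then composed with `m_x`, times functions of `y`
alone. At `y = 0` those functions become constants, and a polynomial in the vector fields remains
(`mem_expDiffOps_of_invariant`). The operator `ι_* L` is right invariant and is treated in the same
way with `J⁻¹ Ad(f)⁻¹` in place of `J⁻¹`. The product rule finally moves all multipliers to the left
(`HasExpCoeffs.of_mem_expDiffOps`). -/

namespace ExpSolvable

/-! ### Solvable Lie algebras: ad-nilpotency and the flag of a Malcev basis. -/

section LieAlgebra

open scoped TensorProduct

/-- Elements of the derived algebra of a solvable Lie algebra over an algebraically closed field of
characteristic zero act nilpotently on finite dimensional modules. -/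
theorem isNilpotent_toEnd_of_mem_derivedSeries_of_isAlgClosed {k L : Type*} [Field k] [CharZero k]
    [IsAlgClosed k] [LieRing L] [LieAlgebra k L] [LieAlgebra.IsSolvable L] {x : L}
    (hx : x ∈ LieAlgebra.derivedSeries k L 1) (d : ℕ) :
    ∀ (V : Type*) [AddCommGroup V] [Module k V] [LieRingModule L V] [LieModule k L V]
      [FiniteDimensional k V], Module.finrank k V = d →
      IsNilpotent (LieModule.toEnd k L V x) := by
  induction d using Nat.strong_induction_on with
  | _ d ih =>
    intro V _ _ _ _ _ hd
    rcases subsingleton_or_nontrivial V with hV | hV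
    · exact ⟨1, LinearMap.ext fun v => Subsingleton.elim _ _⟩
    -- Lie's theorem provides a common eigenvector `v`; its line `W` is a submodule, and the
    -- induction runs on `V ⧸ W`.
    obtain ⟨χ, hχ⟩ := LieModule.exists_nontrivial_weightSpace_of_isSolvable k L V
    obtain ⟨⟨v, hv⟩, hv0⟩ := exists_ne (0 : LieModule.weightSpace V χ)
    rw [LieModule.mem_weightSpace] at hv
    have hv0 : v ≠ 0 := fun h => hv0 (Subtype.ext h)
    let W : LieSubmodule k L V :=
      { Submodule.span k {v} with
        lie_mem := by
          intro y w hw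
          obtain ⟨c, rfl⟩ := Submodule.mem_span_singleton.1 hw
          rw [lie_smul, hv]
          exact Submodule.smul_mem _ _ (Submodule.smul_mem _ _ (Submodule.mem_span_singleton_self v)) }
    have hvW : v ∈ W := Submodule.mem_span_singleton_self v
    have hxv : ∀ w ∈ W, ⁅x, w⁆ = 0 := by
      intro w hw
      obtain ⟨c, rfl⟩ := Submodule.mem_span_singleton.1 hw
      rw [lie_smul]
      -- A commutator `⁅a, b⁆` acts on `v` by `χ a χ b - χ b χ a = 0`.
      suffices h : ⁅x, v⁆ = 0 by rw [h, smul_zero]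
      clear ih
      rw [LieAlgebra.derivedSeries_def, LieAlgebra.derivedSeriesOfIdeal_succ,
        LieAlgebra.derivedSeriesOfIdeal_zero, ← LieSubmodule.mem_toSubmodule,
        LieSubmodule.lieIdeal_oper_eq_linear_span'] at hx
      induction hx using Submodule.span_induction with
      | mem y hy =>
        obtain ⟨a, -, b, -, rfl⟩ := hy
        rw [lie_lie, hv, hv, lie_smul, lie_smul, hv, hv, smul_comm, sub_self]
      | zero => exact zero_lie v
      | add y z _ _ hy hz => rw [add_lie, hy, hz, add_zero]
      | smul c y _ hy => rw [smul_lie, hy, smul_zero]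
    have hlt : Module.finrank k (V ⧸ W) < d := by
      have h1 := Submodule.finrank_quotient_add_finrank W.toSubmodule
      have h2 : 0 < Module.finrank k W.toSubmodule :=
        Module.finrank_pos_iff_exists_ne_zero.2 ⟨⟨v, hvW⟩, fun h => hv0 (congrArg Subtype.val h)⟩
      have h3 : Module.finrank k (V ⧸ W) = Module.finrank k (V ⧸ W.toSubmodule) := rfl
      omega
    obtain ⟨r, hr⟩ := ih _ hlt (V ⧸ W) rfl
    -- The power `r` maps `V` into `W`, and one further application of `x` kills `W`.
    refine ⟨r + 1, LinearMap.ext fun w => ?_⟩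
    have hmk : ∀ (s : ℕ) (w : V), (LieSubmodule.Quotient.mk (N := W)
        (((LieModule.toEnd k L V x) ^ s) w) : V ⧸ W) =
        ((LieModule.toEnd k L (V ⧸ W) x) ^ s) (LieSubmodule.Quotient.mk w) := by
      intro s
      induction s with
      | zero => intro w; rfl
      | succ s ihs =>
        intro w
        rw [pow_succ, pow_succ, Module.End.mul_apply, Module.End.mul_apply, ihs]
        rfl
    have hmem : ((LieModule.toEnd k L V x) ^ r) w ∈ W := by
      rw [← LieSubmodule.Quotient.mk_eq_zero]
      exact (hmk r w).trans (by rw [hr]; rfl)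
    rw [pow_succ', Module.End.mul_apply]
    exact hxv _ hmem

/-- Elements of the derived algebra of a real solvable Lie algebra are ad-nilpotent. -/
theorem isNilpotent_ad_of_mem_derivedSeries {L : Type*} [LieRing L] [LieAlgebra ℝ L]
    [FiniteDimensional ℝ L] [LieAlgebra.IsSolvable L] {x : L}
    (hx : x ∈ LieAlgebra.derivedSeries ℝ L 1) : IsNilpotent (LieAlgebra.ad ℝ L x) := by
  -- Lie's theorem needs an algebraically closed field, so nilpotency is proved over `ℂ` and
  -- descends because `L` embeds in `ℂ ⊗ L`.
  have hsol : LieAlgebra.IsSolvable (ℂ ⊗[ℝ] L) := inferInstance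
  have hx' : (1 : ℂ) ⊗ₜ[ℝ] x ∈ LieAlgebra.derivedSeries ℂ (ℂ ⊗[ℝ] L) 1 := by
    rw [LieAlgebra.derivedSeries_baseChange]
    exact LieSubmodule.tmul_mem_baseChange_of_mem _ hx
  obtain ⟨r, hr⟩ := isNilpotent_toEnd_of_mem_derivedSeries_of_isAlgClosed hx' _ (ℂ ⊗[ℝ] L) rfl
  refine ⟨r, LinearMap.ext fun y => ?_⟩
  have key : ∀ s : ℕ, ((LieModule.toEnd ℂ (ℂ ⊗[ℝ] L) (ℂ ⊗[ℝ] L) ((1 : ℂ) ⊗ₜ[ℝ] x)) ^ s)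
      ((1 : ℂ) ⊗ₜ[ℝ] y) = (1 : ℂ) ⊗ₜ[ℝ] (((LieAlgebra.ad ℝ L x) ^ s) y) := by
    intro s
    induction s with
    | zero => rfl
    | succ s ihs =>
      rw [pow_succ', pow_succ', Module.End.mul_apply, Module.End.mul_apply, ihs]
      simp
  have h0 := key r
  rw [hr] at h0
  have hinj := Module.FaithfullyFlat.tensorProduct_mk_injective (A := ℝ) (B := ℂ) L
  apply hinj
  simpa using h0.symm

/-- In a solvable Lie algebra, a subalgebra of codimension one in a subalgebra of the derived algebra
contains the brackets of the latter. -/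
theorem lie_mem_of_codim_one {L : Type*} [LieRing L] [LieAlgebra ℝ L]
    [FiniteDimensional ℝ L] [LieAlgebra.IsSolvable L] {K' : Submodule ℝ L} {e : L}
    (hK' : ∀ X ∈ K', ∀ Y ∈ K', ⁅X, Y⁆ ∈ K')
    (hK : ∀ X ∈ Submodule.span ℝ {e} ⊔ K', ∀ Y ∈ Submodule.span ℝ {e} ⊔ K',
      ⁅X, Y⁆ ∈ Submodule.span ℝ {e} ⊔ K')
    (hD : K' ≤ (LieAlgebra.derivedSeries ℝ L 1).toSubmodule) :
    ∀ X ∈ Submodule.span ℝ {e} ⊔ K', ∀ Y ∈ Submodule.span ℝ {e} ⊔ K', ⁅X, Y⁆ ∈ K' := by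
  have key : ∀ y ∈ K', ⁅y, e⁆ ∈ K' := by
    intro y hy
    by_cases he : e ∈ K'
    · exact hK' y hy e he
    have h1 := hK y (Submodule.mem_sup_right hy) e
      (Submodule.mem_sup_left (Submodule.mem_span_singleton_self e))
    obtain ⟨u, hu, k, hk, huk⟩ := Submodule.mem_sup.1 h1
    obtain ⟨c, rfl⟩ := Submodule.mem_span_singleton.1 hu
    -- Modulo `K'`, `ad y` multiplies `e` by the scalar `c`. Since `ad y` is nilpotent and `e ∉ K'`,
    -- this forces `c = 0`.
    have hpow : ∀ s : ℕ, ((LieAlgebra.ad ℝ L y) ^ s) e - c ^ s • e ∈ K' := by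
      intro s
      induction s with
      | zero => simp
      | succ s ihs =>
        have h2 := hK' y hy _ ihs
        rw [lie_sub, lie_smul, ← huk] at h2
        have h3 : ((LieAlgebra.ad ℝ L y) ^ (s + 1)) e - c ^ (s + 1) • e =
            (⁅y, ((LieAlgebra.ad ℝ L y) ^ s) e⁆ - c ^ s • (c • e + k)) + c ^ s • k := by
          rw [pow_succ', Module.End.mul_apply, LieAlgebra.ad_apply, pow_succ, mul_smul, smul_add]
          module
        rw [h3]
        exact K'.add_mem h2 (K'.smul_mem _ hk)
    obtain ⟨r, hr⟩ := isNilpotent_ad_of_mem_derivedSeries (hD hy)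
    have h4 := hpow r
    rw [hr, LinearMap.zero_apply, zero_sub, Submodule.neg_mem_iff] at h4
    have hc : c = 0 := by
      by_contra hc
      exact he ((Submodule.smul_mem_iff _ (pow_ne_zero r hc)).1 h4)
    rw [← huk, hc, zero_smul, zero_add]
    exact hk
  intro X hX Y hY
  obtain ⟨u, hu, k, hk, rfl⟩ := Submodule.mem_sup.1 hX
  obtain ⟨u', hu', k', hk', rfl⟩ := Submodule.mem_sup.1 hY
  obtain ⟨a, rfl⟩ := Submodule.mem_span_singleton.1 hu
  obtain ⟨a', rfl⟩ := Submodule.mem_span_singleton.1 hu'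
  have h5 : ⁅a • e + k, a' • e + k'⁆ = a' • ⁅k, e⁆ - a • ⁅k', e⁆ + ⁅k, k'⁆ := by
    simp only [lie_add, add_lie, lie_smul, smul_lie, lie_self, smul_zero]
    rw [← lie_skew e k', smul_neg]
    module
  rw [h5]
  exact K'.add_mem (K'.sub_mem (K'.smul_mem _ (key k hk)) (K'.smul_mem _ (key k' hk')))
    (hK' k hk k' hk')

/-- The span of the vectors `b k` with `i ≤ k`. -/
def tailSpan {L : Type*} [AddCommGroup L] [Module ℝ L] {d : ℕ} (b : Fin d → L) (i : ℕ) :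
    Submodule ℝ L :=
  Submodule.span ℝ (b '' {k | i ≤ (k : ℕ)})

theorem tailSpan_antitone {L : Type*} [AddCommGroup L] [Module ℝ L] {d : ℕ} (b : Fin d → L) :
    Antitone (tailSpan b) := fun _ _ hij =>
  Submodule.span_mono (Set.image_mono fun _ hk => le_trans hij hk)

theorem mem_tailSpan {L : Type*} [AddCommGroup L] [Module ℝ L] {d : ℕ} (b : Fin d → L) {i : ℕ}
    {k : Fin d} (hk : i ≤ k) : b k ∈ tailSpan b i :=
  Submodule.subset_span ⟨k, hk, rfl⟩

theorem tailSpan_eq_sup {L : Type*} [AddCommGroup L] [Module ℝ L] {d : ℕ} (b : Fin d → L)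
    (k : Fin d) : tailSpan b k = Submodule.span ℝ {b k} ⊔ tailSpan b (k + 1) := by
  rw [tailSpan, tailSpan, ← Submodule.span_union, ← Set.image_singleton, ← Set.image_union]
  congr 2
  ext j
  simp only [Set.mem_ofPred_eq, Set.singleton_union, Set.mem_insert_iff, Fin.ext_iff]
  omega

/-- If `A` spans a complement of the derived algebra of a solvable Lie algebra and `N` is a Malcev
basis of the derived algebra, then brackets strictly lower the flag defined by the family `(A, N)`. -/
theorem lie_mem_tailSpan_succ {L : Type*} [LieRing L] [LieAlgebra ℝ L]
    [FiniteDimensional ℝ L] [LieAlgebra.IsSolvable L] {n m : ℕ} (A : Fin n → L) (N : Fin m → L)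
    (hspan : Submodule.span ℝ (Set.range N) = Submodule.span ℝ {Z | ∃ X Y : L, ⁅X, Y⁆ = Z})
    (hN : ∀ j : Fin m, ∀ X ∈ Submodule.span ℝ (N '' Set.Ici j),
      ∀ Y ∈ Submodule.span ℝ (N '' Set.Ici j), ⁅X, Y⁆ ∈ Submodule.span ℝ (N '' Set.Ici j))
    (i : ℕ) : ∀ X ∈ tailSpan (Fin.append A N) i, ∀ Y ∈ tailSpan (Fin.append A N) i,
      ⁅X, Y⁆ ∈ tailSpan (Fin.append A N) (i + 1) := by
  have hder : Submodule.span ℝ (Set.range N) ≤ (LieAlgebra.derivedSeries ℝ L 1).toSubmodule := by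
    rw [hspan, Submodule.span_le]
    rintro _ ⟨X, Y, rfl⟩
    exact LieSubmodule.lie_mem_lie (LieSubmodule.mem_top X) (LieSubmodule.mem_top Y)
  have htail : ∀ j : ℕ, tailSpan (Fin.append A N) (n + j) = tailSpan N j := by
    intro j
    rw [tailSpan, tailSpan]
    congr 1
    ext x
    constructor
    · rintro ⟨k, hk, rfl⟩
      induction k using Fin.addCases with
      | left k =>
        exfalso
        have h1 : n + j ≤ (k : ℕ) := hk
        omega
      | right k =>
        have h1 : n + j ≤ n + (k : ℕ) := hk
        exact ⟨k, show j ≤ (k : ℕ) by omega, (Fin.append_right A N k).symm⟩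
    · rintro ⟨k, hk, rfl⟩
      have h1 : j ≤ (k : ℕ) := hk
      exact ⟨Fin.natAdd n k, show n + j ≤ n + (k : ℕ) by omega, Fin.append_right A N k⟩
  have hsub : ∀ j : ℕ, ∀ X ∈ tailSpan N j, ∀ Y ∈ tailSpan N j, ⁅X, Y⁆ ∈ tailSpan N j := by
    intro j
    by_cases hj : j < m
    · exact hN ⟨j, hj⟩
    · have h0 : tailSpan N j = ⊥ := by
        rw [tailSpan, Submodule.span_eq_bot]
        rintro _ ⟨k, hk, rfl⟩
        have h1 : j ≤ (k : ℕ) := hk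
        omega
      intro X hX Y _
      rw [h0, Submodule.mem_bot] at hX
      rw [hX, zero_lie]
      exact Submodule.zero_mem _
  intro X hX Y hY
  -- For `i < n` the derived algebra is contained in the tail `i + 1`. For `i ≥ n` the tails `i` and
  -- `i + 1` are subalgebras of the derived algebra, spanned by the Malcev basis and differing by at
  -- most one dimension.
  rcases lt_or_ge i n with hi | hi
  · have h1 : ⁅X, Y⁆ ∈ tailSpan N 0 := by
      have h2 : tailSpan N 0 = Submodule.span ℝ (Set.range N) := by
        rw [tailSpan, ← Set.image_univ]
        congr 2
        ext k
        simp
      rw [h2, hspan]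
      exact Submodule.subset_span ⟨X, Y, rfl⟩
    rw [← htail] at h1
    exact tailSpan_antitone _ (by omega) h1
  · obtain ⟨j, rfl⟩ := Nat.exists_eq_add_of_le hi
    rw [add_assoc, htail]
    rw [htail] at hX hY
    by_cases hj : j < m
    · have h1 := tailSpan_eq_sup N ⟨j, hj⟩
      simp only at h1
      rw [h1] at hX hY
      refine lie_mem_of_codim_one (hsub (j + 1)) ?_ ?_ X hX Y hY
      · rw [← h1]
        exact hsub j
      · exact le_trans (Submodule.span_mono (Set.image_subset_range _ _)) hder
    · have h0 : tailSpan N j = ⊥ := by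
        rw [tailSpan, Submodule.span_eq_bot]
        rintro _ ⟨k, hk, rfl⟩
        have h1 : j ≤ (k : ℕ) := hk
        omega
      rw [h0, Submodule.mem_bot] at hX
      rw [hX, zero_lie]
      exact Submodule.zero_mem _

end LieAlgebra
-- Group laws in exponential coordinates: adjoint representation and logarithmic derivative.
section GroupLaw

variable {E : Type*} [NormedAddCommGroup E] [NormedSpace ℝ E]

/-- A smooth group law on a vector space for which the lines through the origin are one-parameter
subgroups, that is, a Lie group structure in exponential coordinates. -/
structure ExpGroupLaw (μ : E → E → E) : Prop where
  contDiff : ContDiff ℝ ∞ fun p : E × E => μ p.1 p.2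
  assoc : ∀ x y z, μ (μ x y) z = μ x (μ y z)
  smul_smul : ∀ (X : E) (s t : ℝ), μ (s • X) (t • X) = (s + t) • X

/-- The adjoint representation. -/
noncomputable def adjointRep (μ : E → E → E) (x : E) : E →L[ℝ] E :=
  fderiv ℝ (fun y => μ (μ x y) (-x)) 0

/-- The differential of the adjoint representation. -/
noncomputable def adjointDeriv (μ : E → E → E) (X : E) : E →L[ℝ] E :=
  fderiv ℝ (adjointRep μ) 0 X

/-- The differential at the origin of the left translation by `x`. -/
noncomputable def leftFrame (μ : E → E → E) (x : E) : E →L[ℝ] E :=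
  fderiv ℝ (fun y => μ x y) 0

/-- The left logarithmic derivative of a function with values in the group. -/
noncomputable def leftLog {H : Type*} [NormedAddCommGroup H] [NormedSpace ℝ H] (μ : E → E → E)
    (f : H → E) (x : H) : H →L[ℝ] E :=
  fderiv ℝ (fun y => μ (-f x) (f y)) x

namespace ExpGroupLaw

variable {μ : E → E → E} (h : ExpGroupLaw μ)
  {H : Type*} [NormedAddCommGroup H] [NormedSpace ℝ H]

include h

/-- Unit and inversion are not fields of `ExpGroupLaw`: they are read off from the one-parameter
subgroups, with `0` as the unit and `-x` as the inverse of `x`. -/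
theorem zero_left (x : E) : μ 0 x = x := by
  simpa using h.smul_smul x 0 1

theorem zero_right (x : E) : μ x 0 = x := by
  simpa using h.smul_smul x 1 0

theorem neg_left (x : E) : μ (-x) x = 0 := by
  simpa using h.smul_smul x (-1) 1

theorem neg_right (x : E) : μ x (-x) = 0 := by
  simpa using h.smul_smul x 1 (-1)

theorem neg_left_cancel (x y : E) : μ (-x) (μ x y) = y := by
  rw [← h.assoc, h.neg_left, h.zero_left]

theorem neg_right_cancel (x y : E) : μ x (μ (-x) y) = y := by
  rw [← h.assoc, h.neg_right, h.zero_left]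

theorem left_injective {x y z : E} (hxy : μ x y = μ x z) : y = z := by
  rw [← h.neg_left_cancel x y, hxy, h.neg_left_cancel]

theorem neg_mul (x y : E) : -μ x y = μ (-y) (-x) := by
  apply h.left_injective (x := μ x y)
  rw [h.neg_right, h.assoc, h.neg_right_cancel, h.neg_right]

theorem contDiff_mul {f g : H → E} (hf : ContDiff ℝ ∞ f) (hg : ContDiff ℝ ∞ g) :
    ContDiff ℝ ∞ fun x => μ (f x) (g x) :=
  h.contDiff.comp (hf.prodMk hg)

theorem differentiable_mul {f g : H → E} (hf : Differentiable ℝ f) (hg : Differentiable ℝ g) :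
    Differentiable ℝ fun x => μ (f x) (g x) :=
  (h.contDiff.differentiable (by simp)).comp (hf.prodMk hg)

/-- Since `0` is a two-sided unit, both partial derivatives at the origin are the identity. -/
theorem hasFDerivAt_zero : HasFDerivAt (fun p : E × E => μ p.1 p.2)
    (ContinuousLinearMap.fst ℝ E E + ContinuousLinearMap.snd ℝ E E) (0, 0) := by
  have h0 := (h.contDiff.differentiable (by simp) (0, 0)).hasFDerivAt
  convert! h0 using 1
  have h1 : HasFDerivAt (fun x : E => x)
      ((fderiv ℝ (fun p : E × E => μ p.1 p.2) (0, 0)).comp (ContinuousLinearMap.inl ℝ E E)) 0 := by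
    have := HasFDerivAt.comp (f := fun x : E => (x, (0 : E))) (0 : E) h0 (hasFDerivAt_prodMk_left (𝕜 := ℝ) (0 : E) (0 : E))
    simpa [Function.comp_def, h.zero_right] using this
  have h2 : HasFDerivAt (fun x : E => x)
      ((fderiv ℝ (fun p : E × E => μ p.1 p.2) (0, 0)).comp (ContinuousLinearMap.inr ℝ E E)) 0 := by
    have := HasFDerivAt.comp (f := fun x : E => ((0 : E), x)) (0 : E) h0 (hasFDerivAt_prodMk_right (𝕜 := ℝ) (0 : E) (0 : E))
    simpa [Function.comp_def, h.zero_left] using this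
  have h1' := h1.unique (hasFDerivAt_id (𝕜 := ℝ) (0 : E))
  have h2' := h2.unique (hasFDerivAt_id (𝕜 := ℝ) (0 : E))
  ext v
  · exact (DFunLike.congr_fun h1' v).symm ▸ by simp
  · exact (DFunLike.congr_fun h2' v).symm ▸ by simp

theorem hasFDerivAt_mul_of_eq_zero {f g : H → E} {f' g' : H →L[ℝ] E} {x : H}
    (hf : HasFDerivAt f f' x) (hg : HasFDerivAt g g' x) (hf0 : f x = 0) (hg0 : g x = 0) :
    HasFDerivAt (fun y => μ (f y) (g y)) (f' + g') x := by
  have h0 := h.hasFDerivAt_zero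
  have hfg : (f x, g x) = (0, 0) := by rw [hf0, hg0]
  rw [← hfg] at h0
  have := HasFDerivAt.comp (f := fun y => (f y, g y)) x h0 (hf.prodMk hg)
  convert! this using 1

theorem contDiff_adjointRep : ContDiff ℝ ∞ (adjointRep μ) := by
  unfold adjointRep
  refine ContDiff.fderiv (m := ∞) (f := fun x y => μ (μ x y) (-x)) (g := fun _ => 0) ?_
    contDiff_const (by simp)
  exact h.contDiff_mul (h.contDiff_mul contDiff_fst contDiff_snd) contDiff_fst.neg

theorem contDiff_leftFrame : ContDiff ℝ ∞ (leftFrame μ) := by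
  unfold leftFrame
  exact ContDiff.fderiv (m := ∞) (f := fun x y => μ x y) (g := fun _ => 0) h.contDiff
    contDiff_const (by simp)

theorem contDiff_leftLog {f : H → E} (hf : ContDiff ℝ ∞ f) : ContDiff ℝ ∞ (leftLog μ f) := by
  unfold leftLog
  refine ContDiff.fderiv (m := ∞) (f := fun x y => μ (-f x) (f y)) (g := fun x => x) ?_
    contDiff_id (by simp)
  exact h.contDiff_mul (hf.comp contDiff_fst).neg (hf.comp contDiff_snd)

theorem hasFDerivAt_conj (x : E) :
    HasFDerivAt (fun y => μ (μ x y) (-x)) (adjointRep μ x) 0 :=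
  ((h.contDiff_mul (h.contDiff_mul contDiff_const contDiff_id) contDiff_const).differentiable
    (by simp) 0).hasFDerivAt

theorem hasFDerivAt_leftFrame (x : E) : HasFDerivAt (fun y => μ x y) (leftFrame μ x) 0 :=
  ((h.contDiff_mul contDiff_const contDiff_id).differentiable (by simp) 0).hasFDerivAt

theorem hasFDerivAt_leftLog {f : H → E} {x : H} (hf : DifferentiableAt ℝ f x) :
    HasFDerivAt (fun y => μ (-f x) (f y)) (leftLog μ f x) x :=
  (DifferentiableAt.comp (g := fun z => μ (-f x) z) x
    ((h.contDiff_mul contDiff_const contDiff_id).differentiable (by simp) _) hf).hasFDerivAt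

theorem adjointRep_zero : adjointRep μ 0 = ContinuousLinearMap.id ℝ E := by
  have := h.hasFDerivAt_conj 0
  simp only [h.zero_left, neg_zero, h.zero_right] at this
  exact this.unique (hasFDerivAt_id (𝕜 := ℝ) (0 : E))

theorem adjointRep_mul (x y : E) : adjointRep μ (μ x y) = adjointRep μ x * adjointRep μ y := by
  have h1 := h.hasFDerivAt_conj x
  have h2 : μ (μ y 0) (-y) = 0 := by rw [h.zero_right, h.neg_right]
  rw [← h2] at h1
  have h3 := h1.comp 0 (h.hasFDerivAt_conj y)
  refine (h.hasFDerivAt_conj (μ x y)).unique ?_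
  convert! h3 using 1
  funext z
  simp only [Function.comp_apply, h.neg_mul, h.assoc]

theorem adjointRep_neg_mul_self (x : E) : adjointRep μ (-x) * adjointRep μ x = 1 := by
  rw [← h.adjointRep_mul, h.neg_left, h.adjointRep_zero]
  rfl

theorem hasDerivAt_adjointRep_zero (X : E) :
    HasDerivAt (fun t : ℝ => adjointRep μ (t • X)) (adjointDeriv μ X) 0 := by
  have h1 := (h.contDiff_adjointRep.differentiable (by simp) ((0 : ℝ) • X)).hasFDerivAt
  have h2 : HasDerivAt (fun t : ℝ => t • X) ((1 : ℝ) • X) 0 := (hasDerivAt_id _).smul_const X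
  have h3 := h1.comp_hasDerivAt (0 : ℝ) h2
  simpa [adjointDeriv, Function.comp_def] using h3

theorem hasDerivAt_adjointRep (X : E) (t : ℝ) :
    HasDerivAt (fun t : ℝ => adjointRep μ (t • X))
      (adjointRep μ (t • X) * adjointDeriv μ X) t := by
  have h1 := h.hasDerivAt_adjointRep_zero X
  rw [← sub_self t] at h1
  have h2 := (HasDerivAt.comp_sub_const t t h1).const_mul (adjointRep μ (t • X))
  convert! h2 using 1
  funext s
  rw [← h.adjointRep_mul, h.smul_smul]
  congr 2
  ring

/-- Both sides solve the same linear equation `u' = u a` with `u 0 = 1`, so `Ad(tX) exp(-t a)` has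
zero derivative. The exponential growth of all coefficients originates here. -/
theorem adjointRep_smul [CompleteSpace E] (X : E) (t : ℝ) :
    adjointRep μ (t • X) = NormedSpace.exp (t • adjointDeriv μ X) := by
  set a := adjointDeriv μ X
  have hd : ∀ t : ℝ, HasDerivAt
      (fun t : ℝ => adjointRep μ (t • X) * NormedSpace.exp (t • (-a))) 0 t := by
    intro t
    convert! (h.hasDerivAt_adjointRep X t).mul (hasDerivAt_exp_smul_const' (𝕂 := ℝ) (-a) t) using 1
    rw [mul_assoc, ← mul_add, ← add_mul, add_neg_cancel, zero_mul, mul_zero]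
  have hc := is_const_of_deriv_eq_zero (fun t => (hd t).differentiableAt)
    (fun t => (hd t).deriv) t 0
  simp only [zero_smul, h.adjointRep_zero, NormedSpace.exp_zero] at hc
  have h1 : NormedSpace.exp (t • (-a)) * NormedSpace.exp (t • a) = 1 := by
    let _ : NormedAlgebra ℚ (E →L[ℝ] E) := NormedAlgebra.restrictScalars ℚ ℝ _
    rw [← NormedSpace.exp_add_of_commute, ← smul_add, neg_add_cancel, smul_zero,
      NormedSpace.exp_zero]
    exact ((Commute.refl a).neg_left.smul_left t).smul_right t
  calc adjointRep μ (t • X)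
      = adjointRep μ (t • X) * (NormedSpace.exp (t • (-a)) * NormedSpace.exp (t • a)) := by
        rw [h1, mul_one]
    _ = NormedSpace.exp (t • a) := by
        rw [← mul_assoc, hc, mul_one]
        exact one_mul _

/-- The product rule for the left logarithmic derivative. -/
theorem leftLog_mul {f g : H → E} {x : H} (hf : DifferentiableAt ℝ f x)
    (hg : DifferentiableAt ℝ g x) :
    leftLog μ (fun y => μ (f y) (g y)) x =
      (adjointRep μ (-g x)).comp (leftLog μ f x) + leftLog μ g x := by
  -- `g(x)⁻¹ f(x)⁻¹ f(y) g(y)` is the conjugate of `f(x)⁻¹ f(y)` by `g(x)⁻¹`, times `g(x)⁻¹ g(y)`.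
  -- Both factors are the unit at `y = x`, where the differential of the product is addition.
  have h1 := h.hasFDerivAt_leftLog hf
  have h2 := h.hasFDerivAt_leftLog hg
  have h3 := h.hasFDerivAt_conj (-g x)
  have h30 : μ (-f x) (f x) = 0 := h.neg_left _
  rw [← h30] at h3
  have h4 := h3.comp x h1
  have h5 := h.hasFDerivAt_mul_of_eq_zero h4 h2
    (by simp only [Function.comp_apply, h30, h.zero_right, neg_neg, h.neg_left]) (h.neg_left _)
  refine HasFDerivAt.fderiv ?_
  convert! h5 using 1
  funext y
  simp only [Function.comp_apply, h.neg_mul, h.assoc, neg_neg]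
  rw [h.neg_right_cancel]

/-- The left logarithmic derivative is invariant under left translations. -/
theorem leftLog_const_mul (a : E) (f : H → E) :
    leftLog μ (fun y => μ a (f y)) = leftLog μ f := by
  funext x
  unfold leftLog
  congr 1
  funext y
  rw [h.neg_mul, h.assoc, h.neg_left_cancel]

theorem leftLog_comp {H' : Type*} [NormedAddCommGroup H'] [NormedSpace ℝ H'] {f : H → E}
    {g : H' → H} {x : H'} (hf : DifferentiableAt ℝ f (g x)) (hg : DifferentiableAt ℝ g x) :
    leftLog μ (fun y => f (g y)) x = (leftLog μ f (g x)).comp (fderiv ℝ g x) :=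
  HasFDerivAt.fderiv (HasFDerivAt.comp (g := fun z => μ (-f (g x)) (f z)) x
    (h.hasFDerivAt_leftLog hf) hg.hasFDerivAt)

theorem leftLog_smul_const (l : H →L[ℝ] ℝ) (X : E) (x : H) :
    leftLog μ (fun y => l y • X) x = l.smulRight X := by
  have h1 : (fun y => μ (-(l x • X)) (l y • X)) = fun y => (l y - l x) • X := by
    funext y
    rw [← neg_smul, h.smul_smul]
    congr 1
    ring
  unfold leftLog
  rw [h1]
  exact ((l.hasFDerivAt.sub_const (l x)).smul_const X).fderiv

/-- For the identity map `leftLog` is the Maurer–Cartan form. It is inverse to the left-invariant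
frame because the translations by `x` and `-x` are inverse to each other. -/
theorem leftLog_id_comp_leftFrame (x : E) :
    (leftLog μ (fun y => y) x).comp (leftFrame μ x) = ContinuousLinearMap.id ℝ E := by
  have h1 := h.hasFDerivAt_leftLog (f := fun y => y) (x := x) differentiableAt_id
  have h0 : μ x 0 = x := h.zero_right x
  have h2 : HasFDerivAt (fun y => μ (-x) y) (leftLog μ (fun y => y) x) (μ x 0) := by rwa [h0]
  have h3 := h2.comp 0 (h.hasFDerivAt_leftFrame x)
  have h4 : (fun y => μ (-x) y) ∘ (fun y => μ x y) = id := funext (h.neg_left_cancel x)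
  rw [h4] at h3
  exact h3.unique (hasFDerivAt_id _)

theorem leftFrame_comp_leftLog_id (x : E) :
    (leftFrame μ x).comp (leftLog μ (fun y => y) x) = ContinuousLinearMap.id ℝ E := by
  have h1 := h.hasFDerivAt_leftLog (f := fun y => y) (x := x) differentiableAt_id
  have h0 : μ (-x) x = 0 := h.neg_left x
  have h2 := h.hasFDerivAt_leftFrame x
  rw [← h0] at h2
  have h3 := h2.comp x h1
  have h4 : (fun y => μ x y) ∘ (fun y => μ (-x) y) = id := funext (h.neg_right_cancel x)
  rw [h4] at h3
  exact h3.unique (hasFDerivAt_id _)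

theorem fderiv_eq_leftFrame_comp_leftLog {f : H → E} {x : H} (hf : DifferentiableAt ℝ f x) :
    fderiv ℝ f x = (leftFrame μ (f x)).comp (leftLog μ f x) := by
  have h1 := h.leftLog_comp (f := fun y => y) (g := f) (x := x) differentiableAt_id hf
  change leftLog μ f x = _ at h1
  rw [h1, ← ContinuousLinearMap.comp_assoc, h.leftFrame_comp_leftLog_id,
    ContinuousLinearMap.id_comp]

/-- The derivative of the left logarithmic derivative along a line through the origin. -/
theorem hasDerivAt_leftLog_smul (z : E) (t : ℝ) :
    HasDerivAt (fun t : ℝ => leftLog μ (fun y : E => t • y) z) (adjointRep μ (-(t • z))) t := by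
  -- The product rule for `exp(s y) = exp((s - t) y) exp(t y)` reduces the derivative at `s = t` to
  -- the derivative at `0`.
  have hadd : ∀ s : ℝ, leftLog μ (fun y : E => s • y) z =
      (adjointRep μ (-(t • z))).comp (leftLog μ (fun y : E => (s - t) • y) z) +
        leftLog μ (fun y : E => t • y) z := by
    intro s
    rw [← h.leftLog_mul (by fun_prop) (by fun_prop)]
    congr 1
    funext y
    rw [h.smul_smul]
    congr 1
    ring
  have h0 : HasDerivAt (fun s : ℝ => leftLog μ (fun y : E => s • y) z)
      (ContinuousLinearMap.id ℝ E) 0 := by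
    -- The explicit factor `s` makes the derivative at `0` equal to the value of the Maurer–Cartan
    -- form at the origin, which is the identity.
    have h1 : (fun s : ℝ => leftLog μ (fun y : E => s • y) z) =
        fun s : ℝ => s • leftLog μ (fun y => y) (s • z) := by
      funext s
      have h2 := h.leftLog_comp (f := fun y => y) (g := fun y : E => s • y) (x := z)
        differentiableAt_id (by fun_prop)
      rw [h2]
      have h3 : fderiv ℝ (fun y : E => s • y) z = s • ContinuousLinearMap.id ℝ E :=
        ((hasFDerivAt_id (𝕜 := ℝ) z).const_smul s).fderiv
      rw [h3]
      ext v
      simp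
    rw [h1]
    have h4 : DifferentiableAt ℝ (fun s : ℝ => leftLog μ (fun y => y) (s • z)) 0 :=
      DifferentiableAt.comp (0 : ℝ) ((h.contDiff_leftLog contDiff_id).differentiable (by simp) _)
        (by fun_prop)
    have h5 := (hasDerivAt_id (0 : ℝ)).smul h4.hasDerivAt
    convert! h5 using 1
    have h7 : leftLog μ (fun y : E => y) 0 = ContinuousLinearMap.id ℝ E := by
      have := h.leftLog_id_comp_leftFrame 0
      unfold leftFrame at this
      simp only [h.zero_left] at this
      rwa [fderiv_fun_id, ContinuousLinearMap.comp_id] at this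
    simp [h7]
  rw [← sub_self t] at h0
  have h8 := HasDerivAt.comp_sub_const t t h0
  have h9 : HasDerivAt (fun s : ℝ => (adjointRep μ (-(t • z))) *
      (leftLog μ (fun y : E => (s - t) • y) z) + leftLog μ (fun y : E => t • y) z)
      (adjointRep μ (-(t • z)) * ContinuousLinearMap.id ℝ E) t :=
    (h8.const_mul (adjointRep μ (-(t • z)))).add_const _
  convert! h9 using 1
  funext s
  exact hadd s

end ExpGroupLaw

end GroupLaw
-- The exponential of a subalgebra is a subgroup.
section GroupLaw

variable {E : Type*} [NormedAddCommGroup E] [NormedSpace ℝ E] [FiniteDimensional ℝ E]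

theorem exists_clm_projection (F : Submodule ℝ E) :
    ∃ Q : E →L[ℝ] E, (∀ x, Q x ∈ F) ∧ ∀ x ∈ F, Q x = x := by
  obtain ⟨g, hg⟩ := LinearMap.exists_leftInverse_of_injective F.subtype F.ker_subtype
  refine ⟨LinearMap.toContinuousLinearMap (F.subtype ∘ₗ g), fun x => (g x).2, fun x hx => ?_⟩
  exact congrArg Subtype.val (LinearMap.congr_fun hg ⟨x, hx⟩)

/-- A curve with velocities in a subspace `F` stays in `F`. -/
theorem mem_of_hasDerivAt_mem (F : Submodule ℝ E) {c c' : ℝ → E}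
    (hc : ∀ t, HasDerivAt c (c' t) t) (hc' : ∀ t, c' t ∈ F) (h0 : c 0 ∈ F) (t : ℝ) : c t ∈ F := by
  obtain ⟨Q, hQ, hQF⟩ := exists_clm_projection F
  have hd : ∀ t, HasDerivAt (fun t => c t - Q (c t)) 0 t := by
    intro t
    have h1 := (hc t).sub (Q.hasFDerivAt.comp_hasDerivAt t (hc t))
    rwa [hQF _ (hc' t), sub_self] at h1
  have h2 := is_const_of_deriv_eq_zero (fun t => (hd t).differentiableAt)
    (fun t => (hd t).deriv) t 0
  simp only [hQF _ h0, sub_self] at h2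
  rw [sub_eq_zero.1 h2]
  exact hQ _

/-- If `a` maps `K` into `F ≤ K`, then `exp a` is the identity modulo `F` on `K`. -/
theorem exp_apply_sub_mem {a : E →L[ℝ] E} {K F : Submodule ℝ E} (hFK : F ≤ K)
    (ha : ∀ x ∈ K, a x ∈ F) {x : E} (hx : x ∈ K) : NormedSpace.exp a x - x ∈ F := by
  have hC : CompleteSpace E := FiniteDimensional.complete ℝ E
  have h1 := NormedSpace.exp_series_hasSum_exp' (𝕂 := ℝ) a
  have h2 := (ContinuousLinearMap.apply ℝ E x).hasSum h1
  simp only [ContinuousLinearMap.apply_apply, smul_apply] at h2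
  have h3 := (hasSum_nat_add_iff' 1).2 h2
  rw [Finset.sum_range_one, Nat.factorial_zero, Nat.cast_one, inv_one, one_smul, pow_zero,
    one_apply_eq_self] at h3
  have hpow : ∀ n : ℕ, (a ^ (n + 1)) x ∈ F := by
    intro n
    induction n with
    | zero =>
      rw [zero_add, pow_one]
      exact ha x hx
    | succ n ih =>
      rw [pow_succ']
      exact ha _ (hFK ih)
  refine F.closed_of_finiteDimensional.mem_of_tendsto h3 (Filter.Eventually.of_forall fun s => ?_)
  exact F.sum_mem fun n _ => F.smul_mem _ (hpow n)

namespace ExpGroupLaw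

variable {μ : E → E → E} (h : ExpGroupLaw μ)

include h

theorem adjointRep_apply_sub_mem {K F : Submodule ℝ E} (hFK : F ≤ K) {X : E}
    (hX : ∀ x ∈ K, adjointDeriv μ X x ∈ F) (t : ℝ) {x : E} (hx : x ∈ K) :
    adjointRep μ (t • X) x - x ∈ F := by
  have hC : CompleteSpace E := FiniteDimensional.complete ℝ E
  rw [h.adjointRep_smul]
  exact exp_apply_sub_mem hFK (fun y hy => F.smul_mem t (hX y hy)) hx

variable {F : Submodule ℝ E} (hF : ∀ X ∈ F, ∀ Y ∈ F, adjointDeriv μ X Y ∈ F)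

include hF

/-- The curve `t ↦ leftLog μ (t • ·) z w` starts at `0` and has velocity `Ad(-t z) w`, which stays
in `F` as `F` is stable under `ad z`. The claim is its value at `t = 1`. -/
theorem leftLog_id_apply_mem {z w : E} (hz : z ∈ F) (hw : w ∈ F) :
    leftLog μ (fun y : E => y) z w ∈ F := by
  have h1 : ∀ t : ℝ, HasDerivAt (fun t : ℝ => leftLog μ (fun y : E => t • y) z w)
      (adjointRep μ (-(t • z)) w) t := fun t =>
    (ContinuousLinearMap.apply ℝ E w).hasFDerivAt.comp_hasDerivAt t (h.hasDerivAt_leftLog_smul z t)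
  have h2 := mem_of_hasDerivAt_mem F h1 ?_ ?_ 1
  · simpa using h2
  · intro t
    rw [← neg_smul]
    exact (F.sub_mem_iff_left hw).1 (h.adjointRep_apply_sub_mem le_rfl (hF z hz) _ hw)
  · have h3 := h.leftLog_smul_const (0 : E →L[ℝ] ℝ) (0 : E) z
    simp only [zero_apply, smul_zero] at h3
    simp [h3]

/-- The Maurer–Cartan form restricts to an injective endomorphism of the finite-dimensional space
`F`, which is then surjective; so its inverse preserves `F` too. -/
theorem leftFrame_apply_mem {z w : E} (hz : z ∈ F) (hw : w ∈ F) : leftFrame μ z w ∈ F := by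
  have hmaps : ∀ x ∈ F, (leftLog μ (fun y : E => y) z).toLinearMap x ∈ F :=
    fun x hx => h.leftLog_id_apply_mem hF hz hx
  have hinj : Function.Injective ((leftLog μ (fun y : E => y) z).toLinearMap.restrict hmaps) := by
    intro x y hxy
    have h1 : leftLog μ (fun y : E => y) z x = leftLog μ (fun y : E => y) z y :=
      congrArg Subtype.val hxy
    have h2 := DFunLike.congr_fun (h.leftFrame_comp_leftLog_id z)
    apply Subtype.ext
    have h3 := h2 x
    rw [ContinuousLinearMap.comp_apply, h1, ← ContinuousLinearMap.comp_apply, h2] at h3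
    exact h3.symm
  obtain ⟨u, hu⟩ := LinearMap.surjective_of_injective hinj ⟨w, hw⟩
  have h1 : leftLog μ (fun y : E => y) z u = w := congrArg Subtype.val hu
  rw [← h1, ← ContinuousLinearMap.comp_apply, h.leftFrame_comp_leftLog_id]
  exact u.2

/-- A curve whose left logarithmic derivative takes values in a subalgebra `F` stays in `F`. -/
theorem mem_of_leftLog_mem {c y : ℝ → E} (hc : Differentiable ℝ c) (hy : Continuous y)
    (hyF : ∀ t, y t ∈ F) (hlog : ∀ t, leftLog μ c t 1 = y t) (h0 : c 0 ∈ F) : c 1 ∈ F := by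
  obtain ⟨Q, hQ, hQF⟩ := exists_clm_projection F
  have hderiv : ∀ t, HasDerivAt c (leftFrame μ (c t) (y t)) t := by
    intro t
    have h1 := (hc t).hasFDerivAt.hasDerivAt
    rwa [h.fderiv_eq_leftFrame_comp_leftLog (hc t), ContinuousLinearMap.comp_apply, hlog] at h1
  set P : E →L[ℝ] E := ContinuousLinearMap.id ℝ E - Q with hP
  have hPF : ∀ x ∈ F, P x = 0 := fun x hx => by simp [hP, hQF x hx]
  have hu : ∀ t, HasDerivAt (fun t => P (c t)) (P (leftFrame μ (c t) (y t))) t := fun t =>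
    P.hasFDerivAt.comp_hasDerivAt t (hderiv t)
  obtain ⟨M, hM⟩ := isCompact_Icc.exists_bound_of_continuousOn
    (s := Set.Icc (0 : ℝ) 1) hy.continuousOn
  obtain ⟨R₁, hR₁⟩ := isCompact_Icc.exists_bound_of_continuousOn
    (s := Set.Icc (0 : ℝ) 1) hc.continuous.continuousOn
  obtain ⟨R₂, hR₂⟩ := isCompact_Icc.exists_bound_of_continuousOn
    (s := Set.Icc (0 : ℝ) 1) (Q.continuous.comp hc.continuous).continuousOn
  set B := Metric.closedBall (0 : E) (max R₁ R₂) with hB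
  have hsm : ContDiff ℝ 1 (leftFrame μ) := h.contDiff_leftFrame.of_le (by simp)
  obtain ⟨C, hC⟩ := (hsm.locallyLipschitz.locallyLipschitzOn
    (s := B)).exists_lipschitzOnWith_of_compact (isCompact_closedBall _ _)
  -- Grönwall estimate for the component `P c` transverse to `F`: moving the base point from `c t`
  -- to its projection `Q (c t) ∈ F` makes the transverse velocity vanish, and costs at most a
  -- Lipschitz constant times `‖c t - Q (c t)‖ = ‖P (c t)‖`.
  have hbound : ∀ t ∈ Set.Ico (0 : ℝ) 1, ‖P (leftFrame μ (c t) (y t))‖ ≤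
      (‖P‖ * C * M) * ‖P (c t)‖ := by
    intro t ht
    have ht' : t ∈ Set.Icc (0 : ℝ) 1 := ⟨ht.1, ht.2.le⟩
    have h1 : P (leftFrame μ (c t) (y t)) =
        P ((leftFrame μ (c t) - leftFrame μ (Q (c t))) (y t)) := by
      rw [sub_apply (leftFrame μ (c t)), map_sub P,
        hPF _ (h.leftFrame_apply_mem hF (hQ (c t)) (hyF t)), sub_zero]
    have hc1 : c t ∈ B := by
      rw [hB, mem_closedBall_zero_iff]
      exact (hR₁ t ht').trans (le_max_left _ _)
    have hc2 : Q (c t) ∈ B := by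
      rw [hB, mem_closedBall_zero_iff]
      exact (hR₂ t ht').trans (le_max_right _ _)
    have h2 : ‖leftFrame μ (c t) - leftFrame μ (Q (c t))‖ ≤ C * ‖P (c t)‖ := by
      have := hC.dist_le_mul _ hc1 _ hc2
      rwa [dist_eq_norm, dist_eq_norm] at this
    calc ‖P (leftFrame μ (c t) (y t))‖
        ≤ ‖P‖ * (‖leftFrame μ (c t) - leftFrame μ (Q (c t))‖ * ‖y t‖) := by
          rw [h1]
          exact (P.le_opNorm _).trans (by gcongr; exact ContinuousLinearMap.le_opNorm _ _)
      _ ≤ ‖P‖ * ((C * ‖P (c t)‖) * M) := by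
          gcongr
          exact hM t ht'
      _ = (‖P‖ * C * M) * ‖P (c t)‖ := by ring
  have h3 := eq_zero_of_abs_deriv_le_mul_abs_self_of_eq_zero_right
    (f := fun t => P (c t)) (f' := fun t => P (leftFrame μ (c t) (y t)))
    (P.continuous.comp hc.continuous).continuousOn (fun t _ => (hu t).hasDerivWithinAt)
    (hPF _ h0) hbound 1 (by simp)
  have h4 : c 1 = Q (c 1) := by
    have : c 1 - Q (c 1) = 0 := h3
    exact sub_eq_zero.1 this
  rw [h4]
  exact hQ _

/-- The exponential of a subalgebra is closed under multiplication. -/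
theorem mul_mem {X Y : E} (hX : X ∈ F) (hY : Y ∈ F) : μ X Y ∈ F := by
  have h1 := h.mem_of_leftLog_mem hF (c := fun t : ℝ => μ X (t • Y)) (y := fun _ => Y)
    (h.differentiable_mul (by fun_prop) (by fun_prop)) continuous_const (fun _ => hY) ?_
    (by simpa [h.zero_right] using hX)
  · simpa using h1
  · intro t
    rw [h.leftLog_const_mul]
    have := h.leftLog_smul_const (ContinuousLinearMap.id ℝ ℝ) Y t
    simp only [ContinuousLinearMap.id_apply] at this
    simp [this]

omit hF in
/-- If brackets map `ℝ e + F` into `F`, then `exp (-s e) exp (s e + Y)` belongs to `exp F` for all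
`Y` in `F`. -/
theorem neg_smul_mul_mem {e : E} (hK : ∀ X ∈ Submodule.span ℝ {e} ⊔ F,
    ∀ Y ∈ Submodule.span ℝ {e} ⊔ F, adjointDeriv μ X Y ∈ F) {Y : E} (hY : Y ∈ F) (s : ℝ) :
    μ (-(s • e)) (s • e + Y) ∈ F := by
  have hFK : F ≤ Submodule.span ℝ {e} ⊔ F := le_sup_right
  have he : e ∈ Submodule.span ℝ {e} ⊔ F :=
    Submodule.mem_sup_left (Submodule.mem_span_singleton_self e)
  set X := s • e + Y with hXdef
  have hX : X ∈ Submodule.span ℝ {e} ⊔ F :=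
    Submodule.add_mem _ (Submodule.smul_mem _ s he) (hFK hY)
  -- The curve `exp(-t s e) exp(t X)` joins `0` to the element in question. Its logarithmic
  -- derivative `Ad(-t X)(-s e) + X` is congruent to `-s e + X = Y` modulo `F`, hence lies in `F`.
  have h1 := h.mem_of_leftLog_mem (fun x hx y hy => hK x (hFK hx) y (hFK hy))
    (c := fun t : ℝ => μ (t • (-(s • e))) (t • X))
    (y := fun t => adjointRep μ (-(t • X)) (-(s • e)) + X)
    (h.differentiable_mul (by fun_prop) (by fun_prop)) ?_ ?_ ?_ ?_
  · simpa using h1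
  · have h2 : Continuous (adjointRep μ) := h.contDiff_adjointRep.continuous
    exact ((h2.comp (by fun_prop)).clm_apply continuous_const).add continuous_const
  · intro t
    have h2 := h.adjointRep_apply_sub_mem hFK (hK X hX) (-t) he
    have h3 : adjointRep μ (-(t • X)) (-(s • e)) + X =
        Y - s • (adjointRep μ (-t • X) e - e) := by
      rw [hXdef, neg_smul, map_neg, map_smul, smul_sub]
      abel
    rw [h3]
    exact F.sub_mem hY (F.smul_mem _ h2)
  · intro t
    have h2 := h.leftLog_smul_const (ContinuousLinearMap.id ℝ ℝ) (-(s • e)) t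
    have h3 := h.leftLog_smul_const (ContinuousLinearMap.id ℝ ℝ) X t
    simp only [ContinuousLinearMap.id_apply] at h2 h3
    rw [h.leftLog_mul (by fun_prop) (by fun_prop), h2, h3]
    simp
  · simp [h.zero_left]

end ExpGroupLaw

end GroupLaw
-- Coordinates of the second kind.
section CoordProd

variable {E : Type*} [NormedAddCommGroup E] [NormedSpace ℝ E] [FiniteDimensional ℝ E] {d : ℕ}

omit [FiniteDimensional ℝ E] in
theorem coord_eq_zero_of_mem_tailSpan (b : Module.Basis (Fin d) ℝ E) {i : ℕ} {k : Fin d} (hk : k < i)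
    {x : E} (hx : x ∈ tailSpan b i) : b.coord k x = 0 := by
  have h1 : tailSpan b i ≤ LinearMap.ker (b.coord k) := by
    rw [tailSpan, Submodule.span_le]
    rintro _ ⟨j, hj, rfl⟩
    have hj' : i ≤ (j : ℕ) := hj
    have hjk : j ≠ k := fun h => by subst h; omega
    simp [Finsupp.single_eq_of_ne' hjk]
  exact h1 hx

omit [FiniteDimensional ℝ E] in
theorem tailSpan_eq_bot (b : Fin d → E) : tailSpan b d = ⊥ := by
  rw [tailSpan, Submodule.span_eq_bot]
  rintro _ ⟨k, hk, rfl⟩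
  have h1 : d ≤ (k : ℕ) := hk
  omega

/-- The product of the elements `exp (c k z • b k)` over a list of indices `k`, where `c k z` is the
coordinate of `z` with respect to the basis `b`. -/
noncomputable def coordProd (μ : E → E → E) (b : Module.Basis (Fin d) ℝ E) : List (Fin d) → E → E
  | [], _ => 0
  | k :: l, z => μ (b.coord k z • b k) (coordProd μ b l z)

/-- The coordinates with respect to a basis, as continuous functionals. -/
noncomputable def coordCLM (b : Module.Basis (Fin d) ℝ E) (k : Fin d) : E →L[ℝ] ℝ :=
  LinearMap.toContinuousLinearMap (b.coord k)

theorem coordCLM_apply (b : Module.Basis (Fin d) ℝ E) (k : Fin d) (x : E) :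
    coordCLM b k x = b.coord k x := rfl

omit [FiniteDimensional ℝ E] in
theorem coordProd_congr (μ : E → E → E) (b : Module.Basis (Fin d) ℝ E) {l : List (Fin d)} {z z' : E}
    (hz : ∀ k ∈ l, b.coord k z = b.coord k z') : coordProd μ b l z = coordProd μ b l z' := by
  induction l with
  | nil => rfl
  | cons k l ih =>
    rw [coordProd, coordProd, hz k List.mem_cons_self,
      ih fun j hj => hz j (List.mem_cons_of_mem _ hj)]

namespace ExpGroupLaw

variable {μ : E → E → E} (h : ExpGroupLaw μ) (b : Module.Basis (Fin d) ℝ E)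

include h

theorem contDiff_coordProd (l : List (Fin d)) : ContDiff ℝ ∞ (coordProd μ b l) := by
  induction l with
  | nil => exact contDiff_const
  | cons k l ih =>
    exact h.contDiff_mul ((coordCLM b k).contDiff.smul contDiff_const) ih

omit [FiniteDimensional ℝ E] in
theorem coordProd_zero (l : List (Fin d)) : coordProd μ b l 0 = 0 := by
  induction l with
  | nil => rfl
  | cons k l ih => rw [coordProd, ih, map_zero, zero_smul, h.zero_left]

omit [FiniteDimensional ℝ E] in
theorem leftLog_coordProd_nil (z : E) : leftLog μ (coordProd μ b []) z = 0 := by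
  have h3 := h.leftLog_smul_const (0 : E →L[ℝ] ℝ) (0 : E) z
  simp only [zero_apply, smul_zero] at h3
  exact h3.trans (by ext; simp)

theorem leftLog_coordProd_cons (k : Fin d) (l : List (Fin d)) (z : E) :
    leftLog μ (coordProd μ b (k :: l)) z =
      (adjointRep μ (-coordProd μ b l z)).comp ((coordCLM b k).smulRight (b k)) +
        leftLog μ (coordProd μ b l) z := by
  have h1 := h.leftLog_mul (f := fun y => coordCLM b k y • b k) (g := coordProd μ b l) (x := z)
    (by fun_prop) ((h.contDiff_coordProd b l).differentiable (by simp) z)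
  rwa [h.leftLog_smul_const] at h1

omit [FiniteDimensional ℝ E] in
theorem adjointRep_neg_coordProd_cons (k : Fin d) (l : List (Fin d)) (z : E) :
    adjointRep μ (-coordProd μ b (k :: l) z) =
      adjointRep μ (-coordProd μ b l z) * adjointRep μ ((-b.coord k z) • b k) := by
  rw [coordProd, h.neg_mul, h.adjointRep_mul, neg_smul]

variable (hb : ∀ i, ∀ X ∈ tailSpan b i, ∀ Y ∈ tailSpan b i,
  adjointDeriv μ X Y ∈ tailSpan b (i + 1))

include hb

/-- Each factor has its generator in the tail `i`, so its adjoint action moves the tail `i` only by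
elements of the tail `i + 1`; this survives composition. -/
theorem adjointRep_neg_coordProd_sub_mem {i : ℕ} {l : List (Fin d)} (hl : ∀ k ∈ l, i ≤ (k : ℕ))
    (z : E) {x : E} (hx : x ∈ tailSpan b i) :
    adjointRep μ (-coordProd μ b l z) x - x ∈ tailSpan b (i + 1) := by
  induction l generalizing x with
  | nil => simp [coordProd, h.adjointRep_zero]
  | cons k l ih =>
    have hle : tailSpan b (i + 1) ≤ tailSpan b i := tailSpan_antitone b (Nat.le_succ i)
    have h1 : adjointRep μ ((-b.coord k z) • b k) x - x ∈ tailSpan b (i + 1) :=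
      h.adjointRep_apply_sub_mem hle
        (hb i _ (mem_tailSpan b (hl k List.mem_cons_self))) _ hx
    have h2 := ih (fun j hj => hl j (List.mem_cons_of_mem _ hj))
      ((Submodule.sub_mem_iff_left _ hx).1 (hle h1))
    rw [h.adjointRep_neg_coordProd_cons]
    have h3 := Submodule.add_mem _ h2 h1
    rwa [sub_add_sub_cancel] at h3

/-- The variable `z_k` occurs only in the factor of index `k`, so column `k` is Ad⁻¹ of the product
of the later factors applied to `b k`. As the list is increasing, those factors come from indices
above `k`. -/
theorem leftLog_coordProd_sub_mem {l : List (Fin d)} (hl : l.Pairwise (· < ·)) {k : Fin d} (z : E) :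
    (k ∈ l → leftLog μ (coordProd μ b l) z (b k) - b k ∈ tailSpan b (k + 1)) ∧
      (k ∉ l → leftLog μ (coordProd μ b l) z (b k) = 0) := by
  induction l with
  | nil => simp [h.leftLog_coordProd_nil]
  | cons j l ih =>
    rw [List.pairwise_cons] at hl
    obtain ⟨ih1, ih2⟩ := ih hl.2
    rw [h.leftLog_coordProd_cons]
    by_cases hkj : k = j
    · subst hkj
      have hkl : k ∉ l := fun hk => lt_irrefl _ (hl.1 k hk)
      refine ⟨fun _ => ?_, fun hk => absurd List.mem_cons_self hk⟩
      rw [add_apply, ih2 hkl, add_zero]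
      have h1 := h.adjointRep_neg_coordProd_sub_mem b hb (i := k) (l := l)
        (fun a ha => (hl.1 a ha).le) z (mem_tailSpan b le_rfl)
      simpa [coordCLM_apply] using h1
    · have h0 : (coordCLM b j) (b k) = 0 := by
        simp [coordCLM_apply, Finsupp.single_eq_of_ne' hkj]
      have h1 : ((adjointRep μ (-coordProd μ b l z)).comp ((coordCLM b j).smulRight (b j)) +
          leftLog μ (coordProd μ b l) z) (b k) = leftLog μ (coordProd μ b l) z (b k) := by
        simp [h0]
      rw [h1]
      constructor
      · intro hk
        exact ih1 ((List.mem_cons.1 hk).resolve_left hkj)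
      · intro hk
        exact ih2 fun hk' => hk (List.mem_cons_of_mem _ hk')

omit [FiniteDimensional ℝ E] h in
theorem tailSpan_lie_mem (i : ℕ) : ∀ X ∈ tailSpan b i, ∀ Y ∈ tailSpan b i,
    adjointDeriv μ X Y ∈ tailSpan b i := fun X hX Y hY =>
  tailSpan_antitone b (Nat.le_succ i) (hb i X hX Y hY)

theorem coordProd_mem {i : ℕ} {l : List (Fin d)} (hl : ∀ k ∈ l, i ≤ (k : ℕ)) (z : E) :
    coordProd μ b l z ∈ tailSpan b i := by
  induction l with
  | nil => exact Submodule.zero_mem _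
  | cons k l ih =>
    exact h.mul_mem (tailSpan_lie_mem b hb i)
      (Submodule.smul_mem _ _ (mem_tailSpan b (hl k List.mem_cons_self)))
      (ih fun j hj => hl j (List.mem_cons_of_mem _ hj))

omit [FiniteDimensional ℝ E] h hb in
theorem le_of_mem_drop_finRange {i : ℕ} {k : Fin d} (hk : k ∈ (List.finRange d).drop i) :
    i ≤ (k : ℕ) := by
  obtain ⟨j, hj, rfl⟩ := List.mem_iff_getElem.1 hk
  simp

omit [FiniteDimensional ℝ E] h hb in
theorem drop_finRange_eq_cons {i : ℕ} (hi : i < d) :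
    (List.finRange d).drop i = ⟨i, hi⟩ :: (List.finRange d).drop (i + 1) := by
  rw [List.drop_eq_getElem_cons (by simpa using hi)]
  simp

/-- Surjectivity by splitting off one factor: for `X = s b_i + Y` with `Y` in the tail `i + 1`,
`neg_smul_mul_mem` puts `exp(-s b_i) exp X` into the exponential of that tail. The variable `j = d -
i` turns this descent into an induction. -/
theorem exists_coordProd_eq (j : ℕ) : ∀ i, i + j = d → ∀ X ∈ tailSpan b i,
    ∃ z ∈ tailSpan b i, coordProd μ b ((List.finRange d).drop i) z = X := by
  induction j with
  | zero =>
    rintro i hi X hX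
    obtain rfl : i = d := hi
    rw [tailSpan_eq_bot, Submodule.mem_bot] at hX
    exact ⟨0, Submodule.zero_mem _, by rw [hX, h.coordProd_zero]⟩
  | succ j ih =>
    intro i hi X hX
    have hid : i < d := by omega
    have hsup := tailSpan_eq_sup b ⟨i, hid⟩
    simp only at hsup
    have hX' := hX
    rw [hsup] at hX'
    obtain ⟨u, hu, Y, hY, rfl⟩ := Submodule.mem_sup.1 hX'
    obtain ⟨s, rfl⟩ := Submodule.mem_span_singleton.1 hu
    have hW := h.neg_smul_mul_mem (e := b ⟨i, hid⟩) (F := tailSpan b (i + 1))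
      (by rw [← hsup]; exact hb i) hY s
    obtain ⟨z, hz, hzW⟩ := ih (i + 1) (by omega) _ hW
    refine ⟨s • b ⟨i, hid⟩ + z, Submodule.add_mem _
      (Submodule.smul_mem _ _ (mem_tailSpan b le_rfl))
      (tailSpan_antitone b (Nat.le_succ i) hz), ?_⟩
    have hcoord : b.coord ⟨i, hid⟩ (s • b ⟨i, hid⟩ + z) = s := by
      rw [map_add, coord_eq_zero_of_mem_tailSpan b (Nat.lt_succ_self i) hz]
      simp
    -- The remaining factors only involve coordinates beyond `i`, which adding `s b_i` leaves
    -- unchanged.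
    have hcongr : coordProd μ b ((List.finRange d).drop (i + 1)) (s • b ⟨i, hid⟩ + z) =
        coordProd μ b ((List.finRange d).drop (i + 1)) z := by
      apply coordProd_congr
      intro k hk
      have hik := le_of_mem_drop_finRange hk
      have hne : (⟨i, hid⟩ : Fin d) ≠ k := fun h => by subst h; simp at hik
      simp [Finsupp.single_eq_of_ne' hne]
    rw [drop_finRange_eq_cons hid, coordProd, hcoord, hcongr, hzW, h.neg_right_cancel]

/-- If `exp(s e) Y = exp(s' e) Y'` with `Y`, `Y'` in the tail `i + 1`, then `(s - s') e = Y' Y⁻¹` is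
in that tail by `mul_mem`, so `s = s'`; cancelling this factor leaves the same problem for `i + 1`.
-/
theorem coord_eq_of_coordProd_eq {z z' : E} (j : ℕ) : ∀ i, i + j = d →
    coordProd μ b ((List.finRange d).drop i) z = coordProd μ b ((List.finRange d).drop i) z' →
    ∀ k : Fin d, i ≤ (k : ℕ) → b.coord k z = b.coord k z' := by
  induction j with
  | zero =>
    rintro i hi - k hk
    omega
  | succ j ih =>
    intro i hi hzz k hk
    have hid : i < d := by omega
    rw [drop_finRange_eq_cons hid, coordProd, coordProd] at hzz
    set e := b ⟨i, hid⟩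
    set s := b.coord ⟨i, hid⟩ z
    set s' := b.coord ⟨i, hid⟩ z'
    set Y := coordProd μ b ((List.finRange d).drop (i + 1)) z with hYdef
    set Y' := coordProd μ b ((List.finRange d).drop (i + 1)) z' with hY'def
    have hY : Y ∈ tailSpan b (i + 1) :=
      h.coordProd_mem b hb (fun k hk => le_of_mem_drop_finRange hk) z
    have hY' : Y' ∈ tailSpan b (i + 1) :=
      h.coordProd_mem b hb (fun k hk => le_of_mem_drop_finRange hk) z'
    have h1 : μ ((s - s') • e) Y = Y' := by
      rw [← h.neg_left_cancel (s' • e) Y', ← hzz, ← h.assoc, ← neg_smul, h.smul_smul]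
      congr 2
      ring
    have h2 : (s - s') • e = μ Y' (-Y) := by
      rw [← h1, h.assoc, h.neg_right, h.zero_right]
    have h3 : (s - s') • e ∈ tailSpan b (i + 1) := by
      rw [h2]
      exact h.mul_mem (tailSpan_lie_mem b hb _) hY' (Submodule.neg_mem _ hY)
    have h4 := coord_eq_zero_of_mem_tailSpan b (k := ⟨i, hid⟩) (Nat.lt_succ_self i) h3
    have hss : s = s' := by
      have h5 : s - s' = 0 := by simpa [e] using h4
      exact sub_eq_zero.1 h5
    rcases hk.eq_or_lt with hik | hik
    · obtain rfl : k = ⟨i, hid⟩ := Fin.ext hik.symm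
      exact hss
    · refine ih (i + 1) (by omega) ?_ k hik
      rw [← hYdef, ← hY'def, ← h1, hss, sub_self, zero_smul, h.zero_left]

theorem bijective_coordProd : Function.Bijective (coordProd μ b (List.finRange d)) := by
  constructor
  · intro z z' hzz
    have h1 := h.coord_eq_of_coordProd_eq b hb (z := z) (z' := z') d 0 (by simp) (by simpa using hzz)
    exact b.ext_elem fun k => h1 k (Nat.zero_le _)
  · intro X
    have hX : X ∈ tailSpan b 0 := by
      have : tailSpan b 0 = ⊤ := by
        rw [tailSpan, ← b.span_eq, ← Set.image_univ]
        congr 2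
        ext
        simp
      rw [this]
      trivial
    obtain ⟨z, -, hz⟩ := h.exists_coordProd_eq b hb d 0 (by simp) X hX
    exact ⟨z, by simpa using hz⟩

/-- The matrix of the left logarithmic derivative of the coordinate map is unitriangular. -/
theorem det_leftLog_coordProd (z : E) :
    (LinearMap.toMatrix b b (leftLog μ (coordProd μ b (List.finRange d)) z).toLinearMap).det = 1 := by
  have hmem : ∀ k : Fin d, leftLog μ (coordProd μ b (List.finRange d)) z (b k) - b k ∈
      tailSpan b (k + 1) := fun k =>
    (h.leftLog_coordProd_sub_mem b hb (List.pairwise_lt_finRange d) z).1 (List.mem_finRange k)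
  rw [Matrix.det_of_isLowerTriangular]
  · refine Finset.prod_eq_one fun k _ => ?_
    have h1 := coord_eq_zero_of_mem_tailSpan b (k := k) (Nat.lt_succ_self _) (hmem k)
    rw [map_sub, sub_eq_zero] at h1
    rw [LinearMap.toMatrix_apply]
    exact h1.trans (by simp)
  · intro i k hik
    have hik' : i < k := hik
    have h1 := coord_eq_zero_of_mem_tailSpan b (k := i)
      (Nat.lt_succ_of_lt (Fin.lt_def.1 hik')) (hmem k)
    rw [map_sub, sub_eq_zero] at h1
    rw [LinearMap.toMatrix_apply]
    exact h1.trans (by simp [Finsupp.single_eq_of_ne' hik'.ne'])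

theorem injective_fderiv_coordProd (z : E) :
    Function.Injective (fderiv ℝ (coordProd μ b (List.finRange d)) z) := by
  have h1 := h.det_leftLog_coordProd b hb z
  rw [LinearMap.det_toMatrix] at h1
  have h2 : Function.Injective (leftLog μ (coordProd μ b (List.finRange d)) z).toLinearMap :=
    (LinearMap.equivOfDetNeZero (leftLog μ (coordProd μ b (List.finRange d)) z).toLinearMap
      (by rw [h1]; exact one_ne_zero)).injective
  rw [h.fderiv_eq_leftFrame_comp_leftLog ((h.contDiff_coordProd b _).differentiable (by simp) z)]
  intro v w hvw
  apply h2
  have h3 := congrArg (leftLog μ (fun y => y) (coordProd μ b (List.finRange d) z)) hvw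
  simp only [← ContinuousLinearMap.comp_apply] at h3
  rw [← ContinuousLinearMap.comp_assoc, h.leftLog_id_comp_leftFrame,
    ContinuousLinearMap.id_comp] at h3
  exact h3

/-- The coordinate map `z ↦ ∏ k, exp (c k z • b k)` is a diffeomorphism. -/
theorem exists_diffeomorph_coordProd : ∃ Ψ : E ≃ₘ^∞⟮𝓘(ℝ, E), 𝓘(ℝ, E)⟯ E,
    ∀ z, Ψ z = coordProd μ b (List.finRange d) z := by
  have hC : CompleteSpace E := FiniteDimensional.complete ℝ E
  set f := coordProd μ b (List.finRange d) with hf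
  have hsm : ContDiff ℝ ∞ f := h.contDiff_coordProd b _
  let f' : E → E ≃L[ℝ] E := fun z =>
    (LinearEquiv.ofInjectiveEndo (fderiv ℝ f z).toLinearMap
      (h.injective_fderiv_coordProd b hb z)).toContinuousLinearEquiv
  have hf' : ∀ z, (f' z : E →L[ℝ] E) = fderiv ℝ f z := fun z => by
    ext v
    rfl
  have hder : ∀ z, HasStrictFDerivAt f (f' z : E →L[ℝ] E) z := fun z => by
    rw [hf']
    exact hsm.contDiffAt.hasStrictFDerivAt (by simp)
  -- Openness upgrades the smooth bijection to a homeomorphism; invertibility of the derivatives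
  -- then makes its inverse smooth.
  have hopen : IsOpenMap f := isOpenMap_of_hasStrictFDerivAt_equiv hder
  let e := (Equiv.ofBijective f (h.bijective_coordProd b hb)).toHomeomorphOfContinuousOpen
    hsm.continuous hopen
  have hsymm : ContDiff ℝ ∞ e.symm :=
    e.contDiff_symm (f₀' := f') (fun a => (hder a).hasFDerivAt) hsm
  exact ⟨⟨e.toEquiv, hsm.contMDiff, hsymm.contMDiff⟩, fun z => rfl⟩

end ExpGroupLaw

end CoordProd
-- The algebra `𝒪_M^exp` and the normal form of operators in `𝔇_exp`.
section Multipliers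

variable {V : Type*} [NormedAddCommGroup V] [NormedSpace ℝ V]

theorem dirDeriv_apply (v : V) (f : C^∞⟮𝓘(ℝ, V), V; ℝ⟯) (x : V) :
    dirDeriv v f x = fderiv ℝ f x v := rfl

theorem differentiable_smooth (f : C^∞⟮𝓘(ℝ, V), V; ℝ⟯) : Differentiable ℝ f :=
  f.contMDiff.contDiff.differentiable (by simp)

theorem dirDeriv_mul (v : V) (f g : C^∞⟮𝓘(ℝ, V), V; ℝ⟯) :
    dirDeriv v (f * g) = f * dirDeriv v g + dirDeriv v f * g := by
  ext x
  change fderiv ℝ (fun y => f y * g y) x v = f x * fderiv ℝ g x v + fderiv ℝ f x v * g x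
  rw [fderiv_fun_mul (differentiable_smooth f x) (differentiable_smooth g x)]
  simp [mul_comm]

theorem dirDeriv_algebraMap (v : V) (r : ℝ) :
    dirDeriv v (algebraMap ℝ C^∞⟮𝓘(ℝ, V), V; ℝ⟯ r) = 0 := by
  ext x
  change fderiv ℝ (fun _ => r) x v = 0
  simp

/-- A function is exponentially bounded. -/
def IsExpBounded (f : V → ℝ) : Prop := ∃ B c : ℝ, 0 ≤ c ∧ ∀ x, |f x| ≤ B * Real.exp (c * ‖x‖)

omit [NormedSpace ℝ V] in
theorem IsExpBounded.add {f g : V → ℝ} (hf : IsExpBounded f) (hg : IsExpBounded g) :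
    IsExpBounded fun x => f x + g x := by
  obtain ⟨B, c, hc, hf⟩ := hf
  obtain ⟨B', c', hc', hg⟩ := hg
  refine ⟨|B| + |B'|, max c c', le_max_of_le_left hc, fun x => ?_⟩
  have h1 : |f x| ≤ |B| * Real.exp (max c c' * ‖x‖) := (hf x).trans (by
    gcongr
    exacts [le_abs_self B, le_max_left _ _])
  have h2 : |g x| ≤ |B'| * Real.exp (max c c' * ‖x‖) := (hg x).trans (by
    gcongr
    exacts [le_abs_self B', le_max_right _ _])
  calc |f x + g x| ≤ |f x| + |g x| := abs_add_le _ _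
    _ ≤ _ := by rw [add_mul]; exact add_le_add h1 h2

omit [NormedSpace ℝ V] in
theorem IsExpBounded.mul {f g : V → ℝ} (hf : IsExpBounded f) (hg : IsExpBounded g) :
    IsExpBounded fun x => f x * g x := by
  obtain ⟨B, c, hc, hf⟩ := hf
  obtain ⟨B', c', hc', hg⟩ := hg
  refine ⟨B * B', c + c', add_nonneg hc hc', fun x => ?_⟩
  calc |f x * g x| = |f x| * |g x| := abs_mul _ _
    _ ≤ (B * Real.exp (c * ‖x‖)) * (B' * Real.exp (c' * ‖x‖)) :=
        mul_le_mul (hf x) (hg x) (abs_nonneg _) ((abs_nonneg _).trans (hf x))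
    _ = B * B' * Real.exp ((c + c') * ‖x‖) := by rw [add_mul, Real.exp_add]; ring

omit [NormedSpace ℝ V] in
theorem isExpBounded_const (r : ℝ) : IsExpBounded fun _ : V => r :=
  ⟨|r|, 0, le_rfl, fun x => by simp⟩

omit [NormedSpace ℝ V] in
theorem isExpBounded_iff (f : V → ℝ) : IsExpBounded f ↔ ∃ c : ℝ, 0 < c ∧
    BddAbove (Set.range fun x : V => |f x| * Real.exp (-(c * ‖x‖))) := by
  constructor
  · rintro ⟨B, c, hc, hf⟩
    -- `IsExpBounded` allows the exponent `0`, whereas a positive one is required here.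
    refine ⟨c + 1, by linarith, |B|, ?_⟩
    rintro _ ⟨x, rfl⟩
    simp only
    rw [Real.exp_neg, ← div_eq_mul_inv, div_le_iff₀ (Real.exp_pos _)]
    refine (hf x).trans ?_
    gcongr
    exacts [le_abs_self B, by linarith]
  · rintro ⟨c, hc, B, hB⟩
    refine ⟨B, c, hc.le, fun x => ?_⟩
    have h1 := hB ⟨x, rfl⟩
    simp only at h1
    rwa [Real.exp_neg, ← div_eq_mul_inv, div_le_iff₀ (Real.exp_pos _)] at h1

theorem mem_expMultipliers_iff (f : C^∞⟮𝓘(ℝ, V), V; ℝ⟯) :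
    f ∈ expMultipliers V ↔ ∀ P ∈ constCoeffOps V, IsExpBounded (P f) := by
  simp only [isExpBounded_iff]
  rfl

theorem mem_of_mem_constCoeffOps (S : Submodule ℝ C^∞⟮𝓘(ℝ, V), V; ℝ⟯)
    (hS : ∀ f ∈ S, ∀ v, dirDeriv v f ∈ S) {P : Module.End ℝ C^∞⟮𝓘(ℝ, V), V; ℝ⟯}
    (hP : P ∈ constCoeffOps V) : ∀ f ∈ S, P f ∈ S := by
  unfold constCoeffOps at hP
  induction hP using Algebra.adjoin_induction with
  | mem P hP =>
    obtain ⟨v, rfl⟩ := hP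
    exact fun f hf => hS f hf v
  | algebraMap r =>
    intro f hf
    rw [Module.algebraMap_end_apply]
    exact S.smul_mem r hf
  | add P Q _ _ hP hQ => exact fun f hf => S.add_mem (hP f hf) (hQ f hf)
  | mul P Q _ _ hP hQ => exact fun f hf => hP _ (hQ f hf)

/-- A space of exponentially bounded functions that is closed under directional derivatives consists
of functions in `𝒪_M^exp`. -/
theorem subset_expMultipliers (S : Submodule ℝ C^∞⟮𝓘(ℝ, V), V; ℝ⟯)
    (hS : ∀ f ∈ S, ∀ v, dirDeriv v f ∈ S) (hb : ∀ f ∈ S, IsExpBounded f) :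
    (S : Set C^∞⟮𝓘(ℝ, V), V; ℝ⟯) ⊆ expMultipliers V := fun f hf =>
  (mem_expMultipliers_iff f).2 fun _ hP => hb _ (mem_of_mem_constCoeffOps S hS hP f hf)

theorem dirDeriv_mem_constCoeffOps (v : V) : dirDeriv v ∈ constCoeffOps V :=
  Algebra.subset_adjoin ⟨v, rfl⟩

theorem dirDeriv_mem_expMultipliers {f : C^∞⟮𝓘(ℝ, V), V; ℝ⟯} (hf : f ∈ expMultipliers V) (v : V) :
    dirDeriv v f ∈ expMultipliers V := fun P hP =>
  hf (P * dirDeriv v) (mul_mem hP (dirDeriv_mem_constCoeffOps v))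

variable (V) in
/-- `𝒪_M^exp(V)` as a subalgebra of `C^∞(V)`. -/
noncomputable def expMultiplierAlgebra : Subalgebra ℝ C^∞⟮𝓘(ℝ, V), V; ℝ⟯ :=
  Algebra.adjoin ℝ (expMultipliers V)

theorem dirDeriv_mem_expMultiplierAlgebra {f : C^∞⟮𝓘(ℝ, V), V; ℝ⟯}
    (hf : f ∈ expMultiplierAlgebra V) (v : V) : dirDeriv v f ∈ expMultiplierAlgebra V := by
  unfold expMultiplierAlgebra at *
  induction hf using Algebra.adjoin_induction with
  | mem f hf => exact Algebra.subset_adjoin (dirDeriv_mem_expMultipliers hf v)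
  | algebraMap r =>
    rw [dirDeriv_algebraMap]
    exact zero_mem _
  | add f g _ _ hf hg =>
    rw [map_add]
    exact add_mem hf hg
  | mul f g hf' hg' hf hg =>
    rw [dirDeriv_mul]
    exact add_mem (mul_mem hf' hg) (mul_mem hf hg')

/-- Passing to the generated algebra adds nothing: by the Leibniz rule it is stable under
derivatives, and sums and products of exponentially bounded functions are exponentially bounded, so
`subset_expMultipliers` applies. -/
theorem mem_expMultiplierAlgebra {f : C^∞⟮𝓘(ℝ, V), V; ℝ⟯} :
    f ∈ expMultiplierAlgebra V ↔ f ∈ expMultipliers V := by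
  refine ⟨fun hf => ?_, fun hf => Algebra.subset_adjoin hf⟩
  refine subset_expMultipliers (Subalgebra.toSubmodule (expMultiplierAlgebra V))
    (fun f hf v => dirDeriv_mem_expMultiplierAlgebra hf v) (fun f hf => ?_) hf
  replace hf : f ∈ Algebra.adjoin ℝ (expMultipliers V) := hf
  induction hf using Algebra.adjoin_induction with
  | mem f hf => exact (mem_expMultipliers_iff f).1 hf 1 (one_mem _)
  | algebraMap r => exact isExpBounded_const r
  | add f g _ _ hf hg => exact hf.add hg
  | mul f g _ _ hf hg => exact hf.mul hg

theorem hasExpCoeffs_of_mem_span {P : Module.End ℝ C^∞⟮𝓘(ℝ, V), V; ℝ⟯}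
    (hP : P ∈ Submodule.span ℝ {T | ∃ f ∈ expMultiplierAlgebra V, ∃ Q ∈ constCoeffOps V,
      T = LinearMap.mulLeft ℝ f * Q}) : HasExpCoeffs P := by
  induction hP using Submodule.span_induction with
  | mem T hT =>
    obtain ⟨f, hf, Q, hQ, rfl⟩ := hT
    exact ⟨1, fun _ => f, fun _ => Q, fun _ => mem_expMultiplierAlgebra.1 hf, fun _ => hQ,
      by simp⟩
  | zero => exact ⟨0, Fin.elim0, Fin.elim0, fun k => k.elim0, fun k => k.elim0, by simp⟩
  | add P₁ P₂ _ _ h₁ h₂ =>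
    obtain ⟨r, f, Q, hf, hQ, rfl⟩ := h₁
    obtain ⟨r', f', Q', hf', hQ', rfl⟩ := h₂
    refine ⟨r + r', Fin.append f f', Fin.append Q Q', fun k => ?_, fun k => ?_, ?_⟩
    · induction k using Fin.addCases with
      | left k => simpa using hf k
      | right k => simpa using hf' k
    · induction k using Fin.addCases with
      | left k => simpa using hQ k
      | right k => simpa using hQ' k
    · rw [Fin.sum_univ_add]
      simp
  | smul c P _ h₁ =>
    obtain ⟨r, f, Q, hf, hQ, rfl⟩ := h₁
    refine ⟨r, f, fun k => c • Q k, hf, fun k => Subalgebra.smul_mem _ (hQ k) c, ?_⟩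
    rw [Finset.smul_sum]
    exact Finset.sum_congr rfl fun k _ => (mul_smul_comm _ _ _).symm

/-- The span `S` of the products `f Q` contains `1` and is stable under left multiplication by the
generators of `𝔇_exp`, because `∂_v g = g ∂_v + (∂_v g)` as operators. Thus `P = P * 1` lies in `S`.
-/
theorem HasExpCoeffs.of_mem_expDiffOps {P : Module.End ℝ C^∞⟮𝓘(ℝ, V), V; ℝ⟯}
    (hP : P ∈ expDiffOps V) : HasExpCoeffs P := by
  set S := Submodule.span ℝ {T | ∃ f ∈ expMultiplierAlgebra V, ∃ Q ∈ constCoeffOps V,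
      T = LinearMap.mulLeft ℝ f * Q} with hS
  apply hasExpCoeffs_of_mem_span
  rw [← hS]
  have hmul : ∀ f ∈ expMultiplierAlgebra V, ∀ T ∈ S, LinearMap.mulLeft ℝ f * T ∈ S := by
    intro f hf T hT
    induction hT using Submodule.span_induction with
    | mem T hT =>
      obtain ⟨g, hg, Q, hQ, rfl⟩ := hT
      refine Submodule.subset_span ⟨f * g, mul_mem hf hg, Q, hQ, ?_⟩
      rw [LinearMap.mulLeft_mul, ← mul_assoc]
      rfl
    | zero => rw [mul_zero]; exact S.zero_mem
    | add T T' _ _ h h' => rw [mul_add]; exact S.add_mem h h'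
    | smul c T _ h => rw [mul_smul_comm]; exact S.smul_mem c h
  have hder : ∀ v : V, ∀ T ∈ S, dirDeriv v * T ∈ S := by
    intro v T hT
    induction hT using Submodule.span_induction with
    | mem T hT =>
      obtain ⟨g, hg, Q, hQ, rfl⟩ := hT
      have h1 : dirDeriv v * (LinearMap.mulLeft ℝ g * Q) =
          LinearMap.mulLeft ℝ g * (dirDeriv v * Q) + LinearMap.mulLeft ℝ (dirDeriv v g) * Q :=
        LinearMap.ext fun f => dirDeriv_mul v g (Q f)
      rw [h1]
      exact S.add_mem
        (Submodule.subset_span ⟨g, hg, _, mul_mem (dirDeriv_mem_constCoeffOps v) hQ, rfl⟩)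
        (Submodule.subset_span ⟨_, dirDeriv_mem_expMultiplierAlgebra hg v, Q, hQ, rfl⟩)
    | zero => rw [mul_zero]; exact S.zero_mem
    | add T T' _ _ h h' => rw [mul_add]; exact S.add_mem h h'
    | smul c T _ h => rw [mul_smul_comm]; exact S.smul_mem c h
  have hone : (1 : Module.End ℝ C^∞⟮𝓘(ℝ, V), V; ℝ⟯) ∈ S :=
    Submodule.subset_span ⟨1, one_mem _, 1, one_mem _, by rw [LinearMap.mulLeft_one]; rfl⟩
  suffices h : ∀ T ∈ S, P * T ∈ S by simpa using h 1 hone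
  unfold expDiffOps at hP
  induction hP using Algebra.adjoin_induction with
  | mem P hP =>
    rcases hP with ⟨f, hf, rfl⟩ | hP
    · exact hmul f (mem_expMultiplierAlgebra.2 hf)
    · replace hP : P ∈ Algebra.adjoin ℝ (Set.range dirDeriv) := hP
      induction hP using Algebra.adjoin_induction with
      | mem P hP =>
        obtain ⟨v, rfl⟩ := hP
        exact hder v
      | algebraMap r =>
        intro T hT
        rw [← Algebra.smul_def]
        exact S.smul_mem r hT
      | add P Q _ _ hP hQ =>
        intro T hT
        rw [add_mul]
        exact S.add_mem (hP T hT) (hQ T hT)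
      | mul P Q _ _ hP hQ =>
        intro T hT
        rw [mul_assoc]
        exact hP _ (hQ T hT)
  | algebraMap r =>
    intro T hT
    rw [← Algebra.smul_def]
    exact S.smul_mem r hT
  | add P Q _ _ hP hQ =>
    intro T hT
    rw [add_mul]
    exact S.add_mem (hP T hT) (hQ T hT)
  | mul P Q _ _ hP hQ =>
    intro T hT
    rw [mul_assoc]
    exact hP _ (hQ T hT)

theorem mulLeft_mem_expDiffOps {f : C^∞⟮𝓘(ℝ, V), V; ℝ⟯} (hf : f ∈ expMultiplierAlgebra V) :
    LinearMap.mulLeft ℝ f ∈ expDiffOps V :=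
  Algebra.subset_adjoin (Or.inl ⟨f, mem_expMultiplierAlgebra.1 hf, rfl⟩)

theorem dirDeriv_mem_expDiffOps (v : V) : dirDeriv v ∈ expDiffOps V :=
  Algebra.subset_adjoin (Or.inr (dirDeriv_mem_constCoeffOps v))

end Multipliers

/-! ### Operator-valued functions with entries in `𝒪_M^exp`. -/

section Entries

variable {V : Type*} [NormedAddCommGroup V] [NormedSpace ℝ V]

/-- The matrix entries of the operator valued function `T` belong to `𝒪_M^exp`. -/
def HasExpEntries (T : V → V →L[ℝ] V) : Prop :=
  ∀ (ξ : V →L[ℝ] ℝ) (v : V), ∃ f ∈ expMultiplierAlgebra V, ∀ x, f x = ξ (T x v)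

theorem HasExpEntries.add {T S : V → V →L[ℝ] V} (hT : HasExpEntries T) (hS : HasExpEntries S) :
    HasExpEntries fun x => T x + S x := by
  intro ξ v
  obtain ⟨f, hf, hfT⟩ := hT ξ v
  obtain ⟨g, hg, hgS⟩ := hS ξ v
  refine ⟨f + g, add_mem hf hg, fun x => ?_⟩
  change f x + g x = ξ (T x v + S x v)
  rw [map_add, ← hfT, ← hgS]

theorem hasExpEntries_const (T : V →L[ℝ] V) : HasExpEntries fun _ => T := fun ξ v =>
  ⟨algebraMap ℝ _ (ξ (T v)), Subalgebra.algebraMap_mem _ _, fun _ => rfl⟩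

theorem smooth_sum_apply {ι : Type*} (s : Finset ι) (f : ι → C^∞⟮𝓘(ℝ, V), V; ℝ⟯) (x : V) :
    (∑ i ∈ s, f i) x = ∑ i ∈ s, f i x := by
  classical
  induction s using Finset.induction_on with
  | empty => rfl
  | insert i s hi ih =>
    rw [Finset.sum_insert hi, Finset.sum_insert hi, ← ih]
    rfl

theorem HasExpEntries.comp [FiniteDimensional ℝ V] {T S : V → V →L[ℝ] V} (hT : HasExpEntries T)
    (hS : HasExpEntries S) : HasExpEntries fun x => (T x).comp (S x) := by
  intro ξ v
  let b := Module.finBasis ℝ V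
  choose f hf hfT using fun k => hT ξ (b k)
  choose g hg hgS using fun k => hS (coordCLM b k) v
  refine ⟨∑ k, f k * g k, sum_mem fun k _ => mul_mem (hf k) (hg k), fun x => ?_⟩
  rw [smooth_sum_apply]
  change ∑ k, f k x * g k x = ξ (T x (S x v))
  conv_rhs => rw [← b.sum_repr (S x v), map_sum, map_sum]
  refine Finset.sum_congr rfl fun k _ => ?_
  rw [hfT, hgS, map_smul, map_smul, smul_eq_mul, mul_comm]
  rfl

theorem norm_exp_apply_le [CompleteSpace V] (a : V →L[ℝ] V) (v : V) :
    ‖NormedSpace.exp a v‖ ≤ Real.exp ‖a‖ * ‖v‖ := by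
  have h1 := NormedSpace.exp_series_hasSum_exp' (𝕂 := ℝ) a
  have h2 := (ContinuousLinearMap.apply ℝ V v).hasSum h1
  simp only [ContinuousLinearMap.apply_apply, smul_apply] at h2
  have h3 := (NormedSpace.expSeries_div_hasSum_exp (𝔸 := ℝ) ‖a‖).mul_right ‖v‖
  rw [← Real.exp_eq_exp_ℝ] at h3
  rw [← h2.tsum_eq]
  refine tsum_of_norm_bounded h3 fun n => ?_
  have hpow : ‖(a ^ n) v‖ ≤ ‖a‖ ^ n * ‖v‖ := by
    induction n with
    | zero => simp
    | succ n ih =>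
      rw [pow_succ', mul_apply_eq_comp, pow_succ', mul_assoc]
      exact (a.le_opNorm _).trans (by gcongr)
  rw [norm_smul, norm_inv, Real.norm_natCast, div_eq_inv_mul, mul_assoc]
  gcongr

/-- The function `x ↦ ξ (exp (l x • a) v)`. -/
noncomputable def expEntry [CompleteSpace V] (a : V →L[ℝ] V) (l ξ : V →L[ℝ] ℝ) (v : V) :
    C^∞⟮𝓘(ℝ, V), V; ℝ⟯ :=
  ⟨fun x => ξ (NormedSpace.exp (l x • a) v), by
    have h1 : ContDiff ℝ ∞ (NormedSpace.exp : (V →L[ℝ] V) → (V →L[ℝ] V)) :=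
      contDiff_iff_contDiffAt.2 fun y => (NormedSpace.exp_analytic (𝕂 := ℝ) y).contDiffAt
    exact (ξ.contDiff.comp ((h1.comp (l.contDiff.smul contDiff_const)).clm_apply
      contDiff_const)).contMDiff⟩

theorem dirDeriv_expEntry [CompleteSpace V] (a : V →L[ℝ] V) (l ξ : V →L[ℝ] ℝ) (v w : V) :
    dirDeriv w (expEntry a l ξ v) = l w • expEntry a l ξ (a v) := by
  ext x
  rw [dirDeriv_apply]
  change fderiv ℝ (fun x => ξ (NormedSpace.exp (l x • a) v)) x w =
    l w • ξ (NormedSpace.exp (l x • a) (a v))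
  have h1 : HasDerivAt (fun t : ℝ => ξ (NormedSpace.exp (t • a) v))
      (ξ (NormedSpace.exp (l x • a) (a v))) (l x) :=
    (ξ.comp (ContinuousLinearMap.apply ℝ V v)).hasFDerivAt.comp_hasDerivAt (l x)
      (hasDerivAt_exp_smul_const (𝕂 := ℝ) a (l x))
  have h2 := h1.comp_hasFDerivAt x l.hasFDerivAt
  rw [HasFDerivAt.fderiv (f := fun x => ξ (NormedSpace.exp (l x • a) v)) h2]
  simp [mul_comm]

/-- A derivative of `ξ (exp(l x • a) u)` only replaces `u` by `a u` and adds a scalar factor. So the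
span of these functions over all `u` is stable under derivatives, and each is bounded by a multiple
of `exp(‖l‖ ‖a‖ ‖x‖)`. -/
theorem hasExpEntries_exp [CompleteSpace V] (a : V →L[ℝ] V) (l : V →L[ℝ] ℝ) :
    HasExpEntries fun x => NormedSpace.exp (l x • a) := by
  intro ξ v
  refine ⟨expEntry a l ξ v, mem_expMultiplierAlgebra.2 ?_, fun _ => rfl⟩
  let S := Submodule.span ℝ (Set.range (expEntry a l ξ))
  refine subset_expMultipliers S (fun f hf w => ?_) (fun f hf => ?_)
    (Submodule.subset_span ⟨v, rfl⟩)
  · induction hf using Submodule.span_induction with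
    | mem f hf =>
      obtain ⟨u, rfl⟩ := hf
      rw [dirDeriv_expEntry]
      exact S.smul_mem _ (Submodule.subset_span ⟨_, rfl⟩)
    | zero => rw [map_zero]; exact S.zero_mem
    | add f g _ _ h h' => rw [map_add]; exact S.add_mem h h'
    | smul c f _ h => rw [map_smul]; exact S.smul_mem c h
  · induction hf using Submodule.span_induction with
    | mem f hf =>
      obtain ⟨u, rfl⟩ := hf
      refine ⟨‖ξ‖ * ‖u‖, ‖l‖ * ‖a‖, by positivity, fun x => ?_⟩
      change ‖ξ (NormedSpace.exp (l x • a) u)‖ ≤ _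
      calc ‖ξ (NormedSpace.exp (l x • a) u)‖ ≤ ‖ξ‖ * (Real.exp ‖l x • a‖ * ‖u‖) :=
            (ξ.le_opNorm _).trans (by gcongr; exact norm_exp_apply_le _ _)
        _ ≤ ‖ξ‖ * (Real.exp (‖l‖ * ‖a‖ * ‖x‖) * ‖u‖) := by
            gcongr
            rw [norm_smul, mul_right_comm]
            gcongr
            exact l.le_opNorm x
        _ = _ := by ring
    | zero => exact isExpBounded_const 0
    | add f g _ _ h h' => exact h.add h'
    | smul c f _ h => exact (isExpBounded_const c).mul h

/-- The inverse of an operator valued function with entries in `𝒪_M^exp` and determinant one has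
entries in `𝒪_M^exp`. -/
theorem HasExpEntries.inverse {d : ℕ} [FiniteDimensional ℝ V] (b : Module.Basis (Fin d) ℝ V)
    {T S : V → V →L[ℝ] V} (hT : HasExpEntries T)
    (hdet : ∀ x, (LinearMap.toMatrix b b (T x).toLinearMap).det = 1)
    (hTS : ∀ x, (T x).comp (S x) = ContinuousLinearMap.id ℝ V) : HasExpEntries S := by
  choose f hf hfT using fun (i k : Fin d) => hT (coordCLM b i) (b k)
  -- With the matrix taken over the algebra `𝒪_M^exp`, its adjugate automatically has entries there;
  -- pointwise, determinant one makes the adjugate the inverse.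
  let M : Matrix (Fin d) (Fin d) (expMultiplierAlgebra V) := fun i k => ⟨f i k, hf i k⟩
  let ev : V → expMultiplierAlgebra V →+* ℝ := fun x =>
    (ContMDiffMap.evalRingHom (I := 𝓘(ℝ, V)) (n := ∞) (I' := 𝓘(ℝ, ℝ)) x).comp
      (expMultiplierAlgebra V).val.toRingHom
  have hev : ∀ (x : V) (g : expMultiplierAlgebra V), ev x g = g.1 x := fun x g => rfl
  have hM : ∀ x, (ev x).mapMatrix M = LinearMap.toMatrix b b (T x).toLinearMap := by
    intro x
    ext i k
    rw [LinearMap.toMatrix_apply]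
    exact hfT i k x
  have hS : ∀ x, LinearMap.toMatrix b b (S x).toLinearMap = (ev x).mapMatrix M.adjugate := by
    intro x
    have h1 : LinearMap.toMatrix b b (T x).toLinearMap * LinearMap.toMatrix b b (S x).toLinearMap
        = 1 := by
      rw [← LinearMap.toMatrix_comp]
      have h2 : (T x).toLinearMap ∘ₗ (S x).toLinearMap = LinearMap.id :=
        LinearMap.ext fun v => DFunLike.congr_fun (hTS x) v
      rw [h2, LinearMap.toMatrix_id]
    have h3 := Matrix.adjugate_mul (LinearMap.toMatrix b b (T x).toLinearMap)
    rw [hdet, one_smul] at h3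
    rw [RingHom.map_adjugate, hM, ← one_mul (LinearMap.toMatrix b b (S x).toLinearMap), ← h3,
      mul_assoc, h1, mul_one]
  intro ξ v
  refine ⟨∑ i, ∑ k, algebraMap ℝ _ (ξ (b i) * b.repr v k) * (M.adjugate i k).1,
    sum_mem fun i _ => sum_mem fun k _ =>
      mul_mem (Subalgebra.algebraMap_mem _ _) (M.adjugate i k).2, fun x => ?_⟩
  rw [smooth_sum_apply]
  have h4 : ∀ i, b.repr (S x v) i = ∑ k, (M.adjugate i k).1 x * b.repr v k := by
    intro i
    have h5 := congrFun (LinearMap.toMatrix_mulVec_repr b b (S x).toLinearMap v) i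
    rw [hS] at h5
    exact h5.symm
  conv_rhs => rw [← b.sum_repr (S x v), map_sum]
  refine Finset.sum_congr rfl fun i _ => ?_
  rw [smooth_sum_apply, map_smul, h4, smul_eq_mul, Finset.sum_mul]
  refine Finset.sum_congr rfl fun k _ => ?_
  change (ξ (b i) * b.repr v k) * (M.adjugate i k).1 x = _
  ring

end Entries
-- Hadamard's lemma and differential operators at the origin.
section RadialAverage

variable {V : Type*} [NormedAddCommGroup V] [NormedSpace ℝ V] [FiniteDimensional ℝ V]

omit [FiniteDimensional ℝ V] in
theorem intervalIntegrable_radial (j : ℕ) {f : V → ℝ} (hf : Continuous f) (x : V) :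
    IntervalIntegrable (fun t : ℝ => t ^ j * f (t • x)) MeasureTheory.volume 0 1 :=
  Continuous.intervalIntegrable (by fun_prop) _ _

theorem hasFDerivAt_radialIntegral (j : ℕ) {f : V → ℝ} (hf : ContDiff ℝ 1 f) (x : V) :
    HasFDerivAt (fun x => ∫ t in (0 : ℝ)..1, t ^ j * f (t • x))
      (∫ t in (0 : ℝ)..1, t ^ (j + 1) • fderiv ℝ f (t • x)) x := by
  have hf' : Continuous (fderiv ℝ f) := hf.continuous_fderiv (by simp)
  have hfc : Continuous f := hf.continuous
  obtain ⟨B, hB⟩ := (isCompact_closedBall (0 : V) (‖x‖ + 1)).exists_bound_of_continuousOn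
    hf'.continuousOn
  refine intervalIntegral.hasFDerivAt_integral_of_dominated_of_fderiv_le (𝕜 := ℝ)
    (F := fun x t => t ^ j * f (t • x)) (F' := fun x t => t ^ (j + 1) • fderiv ℝ f (t • x))
    (bound := fun _ => B) (Metric.ball_mem_nhds x one_pos) ?_
    (intervalIntegrable_radial j hfc x) ?_ ?_ intervalIntegrable_const ?_
  · exact Filter.Eventually.of_forall fun y =>
      Continuous.aestronglyMeasurable (by fun_prop)
  · exact Continuous.aestronglyMeasurable (by fun_prop)
  · refine Filter.Eventually.of_forall fun t ht y hy => ?_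
    rw [Set.uIoc_of_le zero_le_one] at ht
    have hy' : ‖y‖ ≤ ‖x‖ + 1 := by
      have h1 := norm_sub_norm_le y x
      have h2 : ‖y - x‖ < 1 := by rwa [← dist_eq_norm]
      linarith
    have hty : t • y ∈ Metric.closedBall (0 : V) (‖x‖ + 1) := by
      rw [mem_closedBall_zero_iff, norm_smul, Real.norm_of_nonneg ht.1.le]
      exact (mul_le_of_le_one_left (norm_nonneg y) ht.2).trans hy'
    rw [norm_smul, norm_pow, Real.norm_of_nonneg ht.1.le]
    exact (mul_le_of_le_one_left (norm_nonneg _) (pow_le_one₀ ht.1.le ht.2)).trans (hB _ hty)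
  · refine Filter.Eventually.of_forall fun t _ y _ => ?_
    have h1 : HasFDerivAt (fun y : V => t • y) (t • ContinuousLinearMap.id ℝ V) y :=
      (hasFDerivAt_id y).const_smul t
    have h2 := (((hf.differentiable (by simp) (t • y)).hasFDerivAt.comp y h1).const_mul (t ^ j))
    convert! h2 using 1
    ext v
    simp [pow_succ, mul_assoc]

theorem fderiv_radialIntegral_apply (j : ℕ) {f : V → ℝ} (hf : ContDiff ℝ 1 f) (x v : V) :
    fderiv ℝ (fun x => ∫ t in (0 : ℝ)..1, t ^ j * f (t • x)) x v =
      ∫ t in (0 : ℝ)..1, t ^ (j + 1) * fderiv ℝ f (t • x) v := by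
  have hf' : Continuous (fderiv ℝ f) := hf.continuous_fderiv (by simp)
  rw [(hasFDerivAt_radialIntegral j hf x).fderiv, ContinuousLinearMap.intervalIntegral_apply]
  · rfl
  · exact Continuous.intervalIntegrable (by fun_prop) _ _

/-- Differentiation replaces `f` by a directional derivative and `j` by `j + 1`, so the induction
must cover all `j` and `f` at once. -/
theorem contDiff_radialIntegral (n : ℕ) : ∀ (j : ℕ) {f : V → ℝ}, ContDiff ℝ ∞ f →
    ContDiff ℝ n fun x => ∫ t in (0 : ℝ)..1, t ^ j * f (t • x) := by
  induction n with
  | zero =>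
    intro j f hf
    exact contDiff_zero.2 (continuous_iff_continuousAt.2 fun x =>
      (hasFDerivAt_radialIntegral j (hf.of_le (by simp)) x).continuousAt)
  | succ n ih =>
    intro j f hf
    have hf1 : ContDiff ℝ 1 f := hf.of_le (by simp)
    rw [Nat.cast_add, Nat.cast_one, contDiff_succ_iff_fderiv_apply]
    refine ⟨fun x => (hasFDerivAt_radialIntegral j hf1 x).differentiableAt, by simp, fun v => ?_⟩
    simp_rw [fderiv_radialIntegral_apply j hf1]
    exact ih (j + 1) (f := fun y => fderiv ℝ f y v)
      ((hf.fderiv_right (m := ∞) (by simp)).clm_apply contDiff_const)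

/-- The operator `f ↦ (x ↦ ∫₀¹ t ^ j f (t x) dt)`. -/
noncomputable def radialAverage (j : ℕ) : Module.End ℝ C^∞⟮𝓘(ℝ, V), V; ℝ⟯ where
  toFun f := ⟨fun x => ∫ t in (0 : ℝ)..1, t ^ j * f (t • x),
    (contDiff_infty.2 fun n => contDiff_radialIntegral n j f.contMDiff.contDiff).contMDiff⟩
  map_add' f g := by
    ext x
    change ∫ t in (0 : ℝ)..1, t ^ j * (f (t • x) + g (t • x)) = _
    simp_rw [mul_add]
    exact intervalIntegral.integral_add (intervalIntegrable_radial j f.contMDiff.continuous x)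
      (intervalIntegrable_radial j g.contMDiff.continuous x)
  map_smul' c f := by
    ext x
    change ∫ t in (0 : ℝ)..1, t ^ j * (c * f (t • x)) = _
    simp_rw [mul_left_comm]
    exact intervalIntegral.integral_const_mul _ _

theorem radialAverage_apply (j : ℕ) (f : C^∞⟮𝓘(ℝ, V), V; ℝ⟯) (x : V) :
    radialAverage j f x = ∫ t in (0 : ℝ)..1, t ^ j * f (t • x) := rfl

theorem dirDeriv_mul_radialAverage (v : V) (j : ℕ) :
    dirDeriv v * radialAverage j = radialAverage (j + 1) * dirDeriv v :=
  LinearMap.ext fun f => by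
    ext x
    exact fderiv_radialIntegral_apply j (f.contMDiff.contDiff.of_le (by simp)) x v

theorem radialAverage_apply_zero (j : ℕ) (f : C^∞⟮𝓘(ℝ, V), V; ℝ⟯) :
    radialAverage j f 0 = (1 / (j + 1) : ℝ) * f 0 := by
  rw [radialAverage_apply]
  simp

/-- A coordinate as a smooth function. -/
noncomputable def smoothCoord {d : ℕ} (b : Module.Basis (Fin d) ℝ V) (k : Fin d) :
    C^∞⟮𝓘(ℝ, V), V; ℝ⟯ :=
  ⟨coordCLM b k, (coordCLM b k).contDiff.contMDiff⟩

/-- Hadamard's lemma. -/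
theorem hadamard {d : ℕ} (b : Module.Basis (Fin d) ℝ V) (f : C^∞⟮𝓘(ℝ, V), V; ℝ⟯) :
    f = algebraMap ℝ _ (f 0) +
      ∑ k, smoothCoord b k * radialAverage 0 (dirDeriv (b k) f) := by
  ext x
  have hf : ContDiff ℝ 1 f := f.contMDiff.contDiff.of_le (by simp)
  have hf' : Continuous (fderiv ℝ f) := hf.continuous_fderiv (by simp)
  have h1 : ∀ t : ℝ, HasDerivAt (fun t : ℝ => f (t • x)) (fderiv ℝ f (t • x) x) t := by
    intro t
    have h2 : HasDerivAt (fun t : ℝ => t • x) x t := by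
      simpa using (hasDerivAt_id t).smul_const x
    exact (differentiable_smooth f (t • x)).hasFDerivAt.comp_hasDerivAt t h2
  have h3 := intervalIntegral.integral_eq_sub_of_hasDerivAt (a := 0) (b := 1) (fun t _ => h1 t)
    (Continuous.intervalIntegrable (by fun_prop) _ _)
  rw [one_smul, zero_smul] at h3
  change f x = f 0 + (∑ k, smoothCoord b k * radialAverage 0 (dirDeriv (b k) f) :
    C^∞⟮𝓘(ℝ, V), V; ℝ⟯) x
  rw [smooth_sum_apply, ← sub_eq_iff_eq_add', ← h3]
  have h4 : ∀ t : ℝ, fderiv ℝ f (t • x) x = ∑ k, b.repr x k * fderiv ℝ f (t • x) (b k) := by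
    intro t
    refine (congrArg (fderiv ℝ f (t • x)) (b.sum_repr x).symm).trans ?_
    rw [map_sum]
    exact Finset.sum_congr rfl fun k _ => map_smul _ _ _
  simp_rw [h4]
  rw [intervalIntegral.integral_finsetSum]
  · refine Finset.sum_congr rfl fun k _ => ?_
    rw [intervalIntegral.integral_const_mul]
    change _ = b.repr x k * radialAverage 0 (dirDeriv (b k) f) x
    rw [radialAverage_apply]
    simp only [pow_zero, one_mul]
    rfl
  · intro k _
    exact Continuous.intervalIntegrable (by fun_prop) _ _

/-- The composition of a constant coefficient operator and a radial average agrees at the origin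
with a constant coefficient operator. -/
theorem exists_constCoeffOps_radialAverage {P : Module.End ℝ C^∞⟮𝓘(ℝ, V), V; ℝ⟯}
    (hP : P ∈ constCoeffOps V) (j : ℕ) :
    ∃ P' ∈ constCoeffOps V, ∀ f, P (radialAverage j f) 0 = P' f 0 := by
  -- Derivatives pass to the right of a radial average at the cost of raising its exponent, and at
  -- the origin the average with exponent `i` is multiplication by `1 / (i + 1)`.
  let S := Submodule.span ℝ {T : Module.End ℝ C^∞⟮𝓘(ℝ, V), V; ℝ⟯ |
    ∃ (i : ℕ) (Q : _) (_ : Q ∈ constCoeffOps V), T = radialAverage i * Q}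
  have hder : ∀ v : V, ∀ T ∈ S, dirDeriv v * T ∈ S := by
    intro v T hT
    induction hT using Submodule.span_induction with
    | mem T hT =>
      obtain ⟨i, Q, hQ, rfl⟩ := hT
      rw [← mul_assoc, dirDeriv_mul_radialAverage, mul_assoc]
      exact Submodule.subset_span ⟨i + 1, _, mul_mem (dirDeriv_mem_constCoeffOps v) hQ, rfl⟩
    | zero => rw [mul_zero]; exact S.zero_mem
    | add T T' _ _ h h' => rw [mul_add]; exact S.add_mem h h'
    | smul c T _ h => rw [mul_smul_comm]; exact S.smul_mem c h
  have hS : ∀ T ∈ S, P * T ∈ S := by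
    unfold constCoeffOps at hP
    induction hP using Algebra.adjoin_induction with
    | mem P hP =>
      obtain ⟨v, rfl⟩ := hP
      exact hder v
    | algebraMap r =>
      intro T hT
      rw [← Algebra.smul_def]
      exact S.smul_mem r hT
    | add P Q _ _ hP hQ =>
      intro T hT
      rw [add_mul]
      exact S.add_mem (hP T hT) (hQ T hT)
    | mul P Q _ _ hP hQ =>
      intro T hT
      rw [mul_assoc]
      exact hP _ (hQ T hT)
  have hval : ∀ T ∈ S, ∃ P' ∈ constCoeffOps V, ∀ f, T f 0 = P' f 0 := by
    intro T hT
    induction hT using Submodule.span_induction with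
    | mem T hT =>
      obtain ⟨i, Q, hQ, rfl⟩ := hT
      refine ⟨(1 / (i + 1) : ℝ) • Q, Subalgebra.smul_mem _ hQ _, fun f => ?_⟩
      exact radialAverage_apply_zero i (Q f)
    | zero => exact ⟨0, zero_mem _, fun f => rfl⟩
    | add T T' _ _ h h' =>
      obtain ⟨P, hP, h⟩ := h
      obtain ⟨P', hP', h'⟩ := h'
      refine ⟨P + P', add_mem hP hP', fun f => ?_⟩
      change T f 0 + T' f 0 = P f 0 + P' f 0
      rw [h, h']
    | smul c T _ h =>
      obtain ⟨P, hP, h⟩ := h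
      refine ⟨c • P, Subalgebra.smul_mem _ hP c, fun f => ?_⟩
      change c * T f 0 = c * P f 0
      rw [h]
  exact hval _ (hS _ (Submodule.subset_span ⟨j, 1, one_mem _, (mul_one _).symm⟩))

/-- At the origin, a differential operator agrees with one with constant coefficients. -/
theorem exists_constCoeffOps_of_isDiffOpOfOrderLE (k : ℕ) :
    ∀ D : Module.End ℝ C^∞⟮𝓘(ℝ, V), V; ℝ⟯, IsDiffOpOfOrderLE k D →
      ∃ P ∈ constCoeffOps V, ∀ f, D f 0 = P f 0 := by
  induction k with
  | zero =>
    intro D hD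
    refine ⟨(D 1 0) • 1, Subalgebra.smul_mem _ (one_mem _) _, fun f => ?_⟩
    have h1 := LinearMap.congr_fun (hD f) 1
    have h2 : D (f * 1) = f * D 1 := sub_eq_zero.1 h1
    rw [mul_one] at h2
    rw [h2]
    exact mul_comm _ _
  | succ k ih =>
    intro D hD
    let b := Module.finBasis ℝ V
    -- Hadamard's lemma gives `f = f(0) + ∑ x_i g_i` with `g_i` the radial average of `∂_i f`. Since
    -- `x_i` vanishes at `0`, `D (x_i g_i) (0) = [D, x_i] g_i (0)`, and this commutator has lower
    -- order.
    choose P hP hPD using fun i => ih _ (hD (smoothCoord b i))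
    choose P' hP' hPP' using fun i => exists_constCoeffOps_radialAverage (hP i) 0
    refine ⟨(D 1 0) • 1 + ∑ i, P' i * dirDeriv (b i),
      add_mem (Subalgebra.smul_mem _ (one_mem _) _)
        (sum_mem fun i _ => mul_mem (hP' i) (dirDeriv_mem_constCoeffOps _)), fun f => ?_⟩
    have h1 : ∀ i, D (smoothCoord b i * radialAverage 0 (dirDeriv (b i) f)) 0 =
        P' i (dirDeriv (b i) f) 0 := by
      intro i
      rw [← hPP', ← hPD]
      change _ = D (smoothCoord b i * radialAverage 0 (dirDeriv (b i) f)) 0 -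
        coordCLM b i 0 * D (radialAverage 0 (dirDeriv (b i) f)) 0
      rw [map_zero (coordCLM b i), zero_mul, sub_zero]
    have h2 : D (algebraMap ℝ _ (f 0)) = f 0 • D 1 := by
      rw [Algebra.algebraMap_eq_smul_one, map_smul]
    conv_lhs => rw [hadamard b f, map_add, map_sum, h2]
    change f 0 * D 1 0 + (∑ i, D (smoothCoord b i * radialAverage 0 (dirDeriv (b i) f)) :
      C^∞⟮𝓘(ℝ, V), V; ℝ⟯) 0 = D 1 0 * f 0 +
        ((∑ i, P' i * dirDeriv (b i) : Module.End ℝ C^∞⟮𝓘(ℝ, V), V; ℝ⟯) f) 0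
    rw [LinearMap.sum_apply, smooth_sum_apply, smooth_sum_apply, mul_comm]
    congr 1
    exact Finset.sum_congr rfl fun i _ => h1 i

end RadialAverage

/-! ### Operators determined by their values at the origin. -/

section Invariant

variable {V : Type*} [NormedAddCommGroup V] [NormedSpace ℝ V] [FiniteDimensional ℝ V]

/-- Composition with a smooth self-map as a linear operator. -/
noncomputable def compOp (φ : C^∞⟮𝓘(ℝ, V), V; 𝓘(ℝ, V), V⟯) :
    Module.End ℝ C^∞⟮𝓘(ℝ, V), V; ℝ⟯ where
  toFun f := f.comp φ
  map_add' _ _ := rfl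
  map_smul' _ _ := rfl

/-- Let `D` be a differential operator that is determined by its values at the origin through a
family `m` of self-maps whose derivatives factor as `T (m x y) ∘ W y`, where the entries of `T`
belong to `𝒪_M^exp`. Then `D` belongs to `𝔇_exp`. -/
theorem mem_expDiffOps_of_invariant {D : Module.End ℝ C^∞⟮𝓘(ℝ, V), V; ℝ⟯} (hD : IsDiffOp D)
    (m : V → C^∞⟮𝓘(ℝ, V), V; 𝓘(ℝ, V), V⟯) (hm0 : ∀ x, m x 0 = x)
    (hinv : ∀ f x, D f x = D (f.comp (m x)) 0) {T W : V → V →L[ℝ] V} (hT : HasExpEntries T)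
    (hW : ContDiff ℝ ∞ W) (hder : ∀ x y, fderiv ℝ (m x) y = (T (m x y)).comp (W y)) :
    D ∈ expDiffOps V := by
  obtain ⟨k, hk⟩ := hD
  obtain ⟨P, hP, hPD⟩ := exists_constCoeffOps_of_isDiffOpOfOrderLE k D hk
  let b := Module.finBasis ℝ V
  choose t ht htT using fun i k => hT (coordCLM b i) (b k)
  -- `X k` is the vector field `z ↦ T z (b k)`; its coefficients are entries of `T`.
  let X : Fin _ → Module.End ℝ C^∞⟮𝓘(ℝ, V), V; ℝ⟯ := fun k =>
    ∑ i, LinearMap.mulLeft ℝ (t i k) * dirDeriv (b i)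
  have hX : ∀ k, X k ∈ expDiffOps V := fun k =>
    sum_mem fun i _ => mul_mem (mulLeft_mem_expDiffOps (ht i k)) (dirDeriv_mem_expDiffOps _)
  have hXapply : ∀ k f z, X k f z = fderiv ℝ f z (T z (b k)) := by
    intro k f z
    change ((∑ i, LinearMap.mulLeft ℝ (t i k) * dirDeriv (b i) :
      Module.End ℝ C^∞⟮𝓘(ℝ, V), V; ℝ⟯) f) z = _
    rw [LinearMap.sum_apply, smooth_sum_apply]
    conv_rhs => rw [← b.sum_repr (T z (b k)), map_sum]
    refine Finset.sum_congr rfl fun i _ => ?_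
    rw [map_smul, smul_eq_mul]
    change t i k z * fderiv ℝ f z (b i) = _
    rw [htT]
    rfl
  let w : V → Fin _ → C^∞⟮𝓘(ℝ, V), V; ℝ⟯ := fun v k =>
    ⟨fun y => coordCLM b k (W y v),
      ((coordCLM b k).contDiff.comp (hW.clm_apply contDiff_const)).contMDiff⟩
  -- Chain rule for `f ∘ m x`. The factorisation of the derivative separates a coefficient `w v k`
  -- depending on `y` alone from a vector field evaluated at `m x y`.
  have hcomm : ∀ v x, dirDeriv v * compOp (m x) =
      ∑ k, LinearMap.mulLeft ℝ (w v k) * (compOp (m x) * X k) := by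
    intro v x
    refine LinearMap.ext fun f => ?_
    ext y
    rw [LinearMap.sum_apply, smooth_sum_apply]
    change fderiv ℝ (fun y => f (m x y)) y v = ∑ k, coordCLM b k (W y v) * X k f (m x y)
    have hdiff : DifferentiableAt ℝ (m x) y :=
      (m x).contMDiff.contDiff.differentiable (by simp) y
    have h1 := (differentiable_smooth f (m x y)).hasFDerivAt.comp y hdiff.hasFDerivAt
    rw [HasFDerivAt.fderiv (f := fun y => f (m x y)) h1, hder]
    change fderiv ℝ f (m x y) (T (m x y) (W y v)) = _
    conv_lhs => rw [← b.sum_repr (W y v), map_sum, map_sum]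
    refine Finset.sum_congr rfl fun k _ => ?_
    rw [map_smul, map_smul, hXapply]
    rfl
  -- Elements of `S` are families indexed by `x`, in which `a` and `Q` must not depend on `x`. Only
  -- `a 0` survives in the end, so mere smoothness of `a`, and hence of `W`, is enough.
  let S := Submodule.span ℝ {F : V → Module.End ℝ C^∞⟮𝓘(ℝ, V), V; ℝ⟯ |
    ∃ (a : C^∞⟮𝓘(ℝ, V), V; ℝ⟯) (Q : _) (_ : Q ∈ expDiffOps V),
      F = fun x => LinearMap.mulLeft ℝ a * (compOp (m x) * Q)}
  have hS : ∀ v : V, ∀ F ∈ S, (fun x => dirDeriv v * F x) ∈ S := by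
    intro v F hF
    induction hF using Submodule.span_induction with
    | mem F hF =>
      obtain ⟨a, Q, hQ, rfl⟩ := hF
      have h1 : (fun x => dirDeriv v * (LinearMap.mulLeft ℝ a * (compOp (m x) * Q))) =
          (fun x => LinearMap.mulLeft ℝ (dirDeriv v a) * (compOp (m x) * Q)) +
            ∑ k, fun x => LinearMap.mulLeft ℝ (a * w v k) * (compOp (m x) * (X k * Q)) := by
        funext x
        have h2 : dirDeriv v * (LinearMap.mulLeft ℝ a * (compOp (m x) * Q)) =
            LinearMap.mulLeft ℝ (dirDeriv v a) * (compOp (m x) * Q) +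
              LinearMap.mulLeft ℝ a * ((dirDeriv v * compOp (m x)) * Q) :=
          LinearMap.ext fun f => (dirDeriv_mul v a _).trans (add_comm _ _)
        rw [h2, hcomm, Pi.add_apply, Finset.sum_apply, Finset.sum_mul, Finset.mul_sum]
        congr 1
        refine Finset.sum_congr rfl fun k _ => LinearMap.ext fun f => ?_
        exact (mul_assoc a (w v k) _).symm
      rw [h1]
      exact S.add_mem (Submodule.subset_span ⟨_, Q, hQ, rfl⟩) (S.sum_mem fun k _ =>
        Submodule.subset_span ⟨_, _, mul_mem (hX k) hQ, rfl⟩)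
    | zero =>
      simp only [Pi.zero_apply, mul_zero]
      exact S.zero_mem
    | add F F' _ _ h h' =>
      simp only [Pi.add_apply, mul_add]
      exact S.add_mem h h'
    | smul c F _ h =>
      simp only [Pi.smul_apply, mul_smul_comm]
      exact S.smul_mem c h
  have hPS : ∀ F ∈ S, (fun x => P * F x) ∈ S := by
    clear hPD
    unfold constCoeffOps at hP
    induction hP using Algebra.adjoin_induction with
    | mem P hP =>
      obtain ⟨v, rfl⟩ := hP
      exact hS v
    | algebraMap r =>
      intro F hF
      simp only [← Algebra.smul_def]
      exact S.smul_mem r hF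
    | add P Q _ _ hP hQ =>
      intro F hF
      simp only [add_mul]
      exact S.add_mem (hP F hF) (hQ F hF)
    | mul P Q _ _ hP hQ =>
      intro F hF
      simp only [mul_assoc]
      exact hP _ (hQ F hF)
  have hval : ∀ F ∈ S, ∃ D' ∈ expDiffOps V, ∀ f x, F x f 0 = D' f x := by
    intro F hF
    induction hF using Submodule.span_induction with
    | mem F hF =>
      obtain ⟨a, Q, hQ, rfl⟩ := hF
      refine ⟨(a 0) • Q, Subalgebra.smul_mem _ hQ _, fun f x => ?_⟩
      change a 0 * Q f (m x 0) = a 0 * Q f x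
      rw [hm0]
    | zero => exact ⟨0, zero_mem _, fun f x => rfl⟩
    | add F F' _ _ h h' =>
      obtain ⟨P, hP, h⟩ := h
      obtain ⟨P', hP', h'⟩ := h'
      refine ⟨P + P', add_mem hP hP', fun f x => ?_⟩
      change F x f 0 + F' x f 0 = P f x + P' f x
      rw [h, h']
    | smul c F _ h =>
      obtain ⟨P, hP, h⟩ := h
      refine ⟨c • P, Subalgebra.smul_mem _ hP c, fun f x => ?_⟩
      change c * F x f 0 = c * P f x
      rw [h]
  have h0 : (fun x => compOp (m x)) ∈ S :=
    Submodule.subset_span ⟨1, 1, one_mem _, by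
      funext x
      rw [mul_one, LinearMap.mulLeft_one]
      rfl⟩
  obtain ⟨D', hD', hDD'⟩ := hval _ (hPS _ h0)
  have hDeq : D = D' := by
    refine LinearMap.ext fun f => ?_
    ext x
    rw [hinv, hPD]
    exact hDD' f x
  rwa [hDeq]

end Invariant
-- Invariant operators in coordinates of the second kind.
namespace ExpGroupLaw

variable {E : Type*} [NormedAddCommGroup E] [NormedSpace ℝ E] [FiniteDimensional ℝ E] {d : ℕ}
  {μ : E → E → E} (h : ExpGroupLaw μ) (b : Module.Basis (Fin d) ℝ E)

include h

/-- Ad of the inverse product is the product, in reverse order, of the operators exp(-z_k ad b_k).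
-/
theorem hasExpEntries_adjointRep_neg_coordProd (l : List (Fin d)) :
    HasExpEntries fun z => adjointRep μ (-coordProd μ b l z) := by
  have hC : CompleteSpace E := FiniteDimensional.complete ℝ E
  induction l with
  | nil =>
    simp only [coordProd]
    exact hasExpEntries_const _
  | cons k l ih =>
    have h1 := ih.comp (hasExpEntries_exp (adjointDeriv μ (b k)) (-coordCLM b k))
    convert! h1 using 2 with z
    rw [h.adjointRep_neg_coordProd_cons, h.adjointRep_smul]
    rfl

theorem hasExpEntries_leftLog_coordProd (l : List (Fin d)) :
    HasExpEntries fun z => leftLog μ (coordProd μ b l) z := by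
  induction l with
  | nil =>
    simp only [h.leftLog_coordProd_nil]
    exact hasExpEntries_const _
  | cons k l ih =>
    simp only [h.leftLog_coordProd_cons]
    exact ((h.hasExpEntries_adjointRep_neg_coordProd b l).comp (hasExpEntries_const _)).add ih

omit [FiniteDimensional ℝ E] h in
theorem leftLog_const (a z : E) : leftLog μ (fun _ : E => a) z = 0 := by
  simp [leftLog]

variable (hb : ∀ i, ∀ X ∈ tailSpan b i, ∀ Y ∈ tailSpan b i,
  adjointDeriv μ X Y ∈ tailSpan b (i + 1))

include hb

theorem exists_inverse_leftLog_coordProd : ∃ S : E → E →L[ℝ] E, HasExpEntries S ∧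
    ∀ z, (S z).comp (leftLog μ (coordProd μ b (List.finRange d)) z) =
      ContinuousLinearMap.id ℝ E := by
  have hdet := h.det_leftLog_coordProd b hb
  let e : E → E ≃ₗ[ℝ] E := fun z =>
    LinearMap.equivOfDetNeZero (leftLog μ (coordProd μ b (List.finRange d)) z).toLinearMap
      (by rw [← LinearMap.det_toMatrix b, hdet]; exact one_ne_zero)
  refine ⟨fun z => (e z).symm.toContinuousLinearEquiv,
    (h.hasExpEntries_leftLog_coordProd b _).inverse b hdet fun z => ?_, fun z => ?_⟩
  · ext v
    exact (e z).apply_symm_apply v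
  · ext v
    exact (e z).symm_apply_apply v

variable {Ψ : E ≃ₘ^∞⟮𝓘(ℝ, E), 𝓘(ℝ, E)⟯ E} (hΨ : ∀ z, Ψ z = coordProd μ b (List.finRange d) z)
  {D : Module.End ℝ C^∞⟮𝓘(ℝ, E), E; ℝ⟯} (hD : IsDiffOp D)
  {m : E → C^∞⟮𝓘(ℝ, E), E; 𝓘(ℝ, E), E⟯}
  (hinv : ∀ f x, D f x = D (f.comp (m x)) 0)

include hΨ hD hinv

/-- Left invariant differential operators have exponentially bounded coefficients in the coordinates
`Ψ`. -/
theorem mem_expDiffOps_of_left_invariant (hm : ∀ x y, Ψ (m x y) = μ (Ψ x) (Ψ y)) :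
    D ∈ expDiffOps E := by
  obtain ⟨S, hS, hSJ⟩ := h.exists_inverse_leftLog_coordProd b hb
  set f := coordProd μ b (List.finRange d) with hf
  have hfs : ContDiff ℝ ∞ f := h.contDiff_coordProd b _
  have hf0 : f 0 = 0 := h.coordProd_zero b _
  simp only [hΨ] at hm
  refine mem_expDiffOps_of_invariant hD m (fun x => ?_) hinv hS (h.contDiff_leftLog hfs)
    fun x y => ?_
  · have h1 := hm x 0
    rw [hf0, h.zero_right] at h1
    exact (h.bijective_coordProd b hb).injective h1
  · have hmd : DifferentiableAt ℝ (m x) y := (m x).contMDiff.contDiff.differentiable (by simp) y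
    -- Taking logarithmic derivatives in `y` of `f(m_x y) = f(x) f(y)` gives `J(m_x y) m_x'(y) =
    -- J(y)`, as the left factor is constant.
    have h1 := h.leftLog_comp (f := f) (g := m x) (x := y)
      (hfs.differentiable (by simp) _) hmd
    simp only [hm] at h1
    rw [h.leftLog_const_mul] at h1
    rw [h1, ← ContinuousLinearMap.comp_assoc, hSJ, ContinuousLinearMap.id_comp]

/-- Right invariant differential operators have exponentially bounded coefficients in the
coordinates `Ψ`. -/
theorem mem_expDiffOps_of_right_invariant (hm : ∀ x y, Ψ (m x y) = μ (Ψ y) (Ψ x)) :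
    D ∈ expDiffOps E := by
  obtain ⟨S, hS, hSJ⟩ := h.exists_inverse_leftLog_coordProd b hb
  set f := coordProd μ b (List.finRange d) with hf
  have hfs : ContDiff ℝ ∞ f := h.contDiff_coordProd b _
  have hf0 : f 0 = 0 := h.coordProd_zero b _
  simp only [hΨ] at hm
  refine mem_expDiffOps_of_invariant hD m (fun x => ?_) hinv
    (hS.comp (h.hasExpEntries_adjointRep_neg_coordProd b (List.finRange d)))
    (W := fun y => (adjointRep μ (f y)).comp (leftLog μ f y))
    ((h.contDiff_adjointRep.comp hfs).clm_comp (h.contDiff_leftLog hfs)) fun x y => ?_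
  · have h1 := hm x 0
    rw [hf0, h.zero_left] at h1
    exact (h.bijective_coordProd b hb).injective h1
  · have hmd : DifferentiableAt ℝ (m x) y := (m x).contMDiff.contDiff.differentiable (by simp) y
    have h1 := h.leftLog_comp (f := f) (g := m x) (x := y)
      (hfs.differentiable (by simp) _) hmd
    simp only [hm] at h1
    rw [h.leftLog_mul (hfs.differentiable (by simp) _) (differentiableAt_const _),
      leftLog_const, add_zero] at h1
    -- Now `f(m_x y) = f(y) f(x)` gives `J(m_x y) m_x'(y) = Ad(f(x))⁻¹ J(y)`. The factor depending
    -- on `x` is split into one depending on `m_x y` and one depending on `y`, as the factorisation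
    -- requires.
    have h2 : adjointRep μ (-f x) = (adjointRep μ (-f (m x y))).comp (adjointRep μ (f y)) := by
      rw [hm, h.neg_mul, h.adjointRep_mul]
      change _ = (adjointRep μ (-f x) * adjointRep μ (-f y)) * adjointRep μ (f y)
      rw [mul_assoc, h.adjointRep_neg_mul_self, mul_one]
    rw [h2] at h1
    have h3 := congrArg (fun A => (S (m x y)).comp A) h1
    simp only [← ContinuousLinearMap.comp_assoc] at h3
    rw [hSJ, ContinuousLinearMap.id_comp] at h3
    rw [← h3]
    simp only [ContinuousLinearMap.comp_assoc, hf]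

end ExpGroupLaw
-- The bracket of left-invariant fields in exponential coordinates.
namespace ExpGroupLaw

variable {E : Type*} [NormedAddCommGroup E] [NormedSpace ℝ E] {μ : E → E → E} (h : ExpGroupLaw μ)

include h

theorem leftFrame_zero : leftFrame μ 0 = ContinuousLinearMap.id ℝ E := by
  unfold leftFrame
  simp only [h.zero_left]
  exact fderiv_fun_id

/-- The bracket of left invariant vector fields is the differential of the adjoint representation. -/
theorem lieBracket_leftFrame (X Y : E) :
    VectorField.lieBracket ℝ (fun x => leftFrame μ x X) (fun x => leftFrame μ x Y) 0 =
      adjointDeriv μ X Y := by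
  set f : E × E → E := fun p => μ p.1 p.2 with hf
  have hfd : ∀ p, HasFDerivAt f (fderiv ℝ f p) p := fun p =>
    (h.contDiff.differentiable (by simp) p).hasFDerivAt
  have hsm : ContDiff ℝ ∞ (fderiv ℝ f) := h.contDiff.fderiv_right (by simp)
  have hf2 : HasFDerivAt (fderiv ℝ f) (fderiv ℝ (fderiv ℝ f) (0, 0)) (0, 0) :=
    (hsm.differentiable (by simp) _).hasFDerivAt
  let r : E → E →L[ℝ] E := fun x => (fderiv ℝ f (0, x)).comp (ContinuousLinearMap.inl ℝ E E)
  have hr : ∀ x, HasFDerivAt (fun z => μ z x) (r x) 0 := fun x =>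
    HasFDerivAt.comp (f := fun z : E => (z, x)) (0 : E) (hfd _)
      (hasFDerivAt_prodMk_left (𝕜 := ℝ) (0 : E) x)
  have hl : ∀ x, leftFrame μ x = (fderiv ℝ f (x, 0)).comp (ContinuousLinearMap.inr ℝ E E) :=
    fun x => HasFDerivAt.fderiv (HasFDerivAt.comp (f := fun z : E => (x, z)) (0 : E) (hfd _)
      (hasFDerivAt_prodMk_right (𝕜 := ℝ) x (0 : E)))
  -- With `r` the right-invariant frame, this differentiates `x y = (x y x⁻¹) x` in `y`.
  have hlr : ∀ x, leftFrame μ x = (r x).comp (adjointRep μ x) := by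
    intro x
    have h1 := hr x
    have h0 : μ (μ x 0) (-x) = 0 := by rw [h.zero_right, h.neg_right]
    rw [← h0] at h1
    have h2 := h1.comp 0 (h.hasFDerivAt_conj x)
    refine (h.hasFDerivAt_leftFrame x).unique ?_
    convert! h2 using 1
    funext y
    simp only [Function.comp_apply, h.assoc, h.neg_left, h.zero_right]
  have hr0 : r 0 = ContinuousLinearMap.id ℝ E := by
    have h1 := hr 0
    simp only [h.zero_right] at h1
    exact h1.unique (hasFDerivAt_id 0)
  have hDl : ∀ u v : E, fderiv ℝ (fun x => leftFrame μ x v) 0 u =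
      fderiv ℝ (fderiv ℝ f) (0, 0) (u, 0) (0, v) := by
    intro u v
    have h1 : HasFDerivAt (fun x : E => fderiv ℝ f (x, 0))
        ((fderiv ℝ (fderiv ℝ f) (0, 0)).comp (ContinuousLinearMap.inl ℝ E E)) 0 :=
      HasFDerivAt.comp (f := fun x : E => (x, (0 : E))) (0 : E) hf2
        (hasFDerivAt_prodMk_left (𝕜 := ℝ) (0 : E) (0 : E))
    have h2 := h1.clm_apply (hasFDerivAt_const ((0 : E), v) (0 : E))
    have h3 : (fun x => leftFrame μ x v) = fun x => fderiv ℝ f (x, 0) (0, v) := by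
      funext x
      rw [hl]
      simp
    rw [h3, h2.fderiv]
    simp
  -- One of the two terms of the bracket is computed through the right-invariant frame. By symmetry
  -- of the second derivative of `μ`, its mixed part cancels the other term and `ad X Y` remains.
  have hDr : fderiv ℝ (fun x => leftFrame μ x Y) 0 X =
      fderiv ℝ (fderiv ℝ f) (0, 0) (0, X) (Y, 0) + adjointDeriv μ X Y := by
    have h1 : HasFDerivAt (fun x : E => fderiv ℝ f (0, x))
        ((fderiv ℝ (fderiv ℝ f) (0, 0)).comp (ContinuousLinearMap.inr ℝ E E)) 0 :=
      HasFDerivAt.comp (f := fun x : E => ((0 : E), x)) (0 : E) hf2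
        (hasFDerivAt_prodMk_right (𝕜 := ℝ) (0 : E) (0 : E))
    have h2 : HasFDerivAt (adjointRep μ) (fderiv ℝ (adjointRep μ) 0) 0 :=
      (h.contDiff_adjointRep.differentiable (by simp) 0).hasFDerivAt
    have h3 := h2.clm_apply (hasFDerivAt_const Y (0 : E))
    have h4 := h1.clm_apply ((ContinuousLinearMap.inl ℝ E E).hasFDerivAt.comp (0 : E) h3)
    have h5 : (fun x => leftFrame μ x Y) =
        fun x => fderiv ℝ f (0, x) ((ContinuousLinearMap.inl ℝ E E) (adjointRep μ x Y)) := by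
      funext x
      rw [hlr]
      rfl
    have h6 : ∀ v : E, fderiv ℝ f (0, 0) (v, 0) = v := fun v => DFunLike.congr_fun hr0 v
    simp only [Function.comp_def] at h4
    rw [h5, h4.fderiv]
    simp [h.adjointRep_zero, h6, adjointDeriv, add_comm]
  have hsymm : fderiv ℝ (fderiv ℝ f) (0, 0) (0, X) (Y, 0) =
      fderiv ℝ (fderiv ℝ f) (0, 0) (Y, 0) (0, X) :=
    (h.contDiff.contDiffAt (x := (0, 0))).isSymmSndFDerivAt
      (by rw [minSmoothness_of_isRCLikeNormedField]; exact ENat.LEInfty.out) _ _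
  rw [VectorField.lieBracket, h.leftFrame_zero]
  change fderiv ℝ (fun x => leftFrame μ x Y) 0 X - fderiv ℝ (fun x => leftFrame μ x X) 0 Y = _
  rw [hDr, hDl, hsymm, add_sub_cancel_left]

end ExpGroupLaw

/-! ### One-parameter subgroups of `G` and the transported group law. -/

section LieGroups

variable {E : Type*} [NormedAddCommGroup E] [NormedSpace ℝ E]
  {G : Type*} [TopologicalSpace G] [ChartedSpace E G] [Group G] [LieGroup 𝓘(ℝ, E) ∞ G]

omit [LieGroup 𝓘(ℝ, E) ∞ G] in
theorem mulInvariantVectorField_one (X : GroupLieAlgebra 𝓘(ℝ, E) G) :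
    mulInvariantVectorField X (1 : G) = X := by
  have h1 : (fun x : G => 1 * x) = id := by
    funext x
    simp
  rw [mulInvariantVectorField, h1, mfderiv_id]
  rfl

theorem mfderiv_mul_left_mulInvariantVectorField (X : GroupLieAlgebra 𝓘(ℝ, E) G) (g k : G) :
    mfderiv 𝓘(ℝ, E) 𝓘(ℝ, E) (fun x => g * x) k (mulInvariantVectorField X k) =
      mulInvariantVectorField X (g * k) := by
  have hmd : ∀ a x : G, MDifferentiableAt 𝓘(ℝ, E) 𝓘(ℝ, E) (fun x => a * x) x := fun a x =>
    (contMDiff_mul_left (I := 𝓘(ℝ, E)) (n := ∞)).contMDiffAt.mdifferentiableAt (by simp)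
  have h1 : (fun x : G => g * k * x) = (fun x => g * x) ∘ fun x => k * x := by
    funext x
    simp [mul_assoc]
  have h2 : mfderiv 𝓘(ℝ, E) 𝓘(ℝ, E) (fun x : G => g * k * x) 1 =
      (mfderiv 𝓘(ℝ, E) 𝓘(ℝ, E) (fun x => g * x) (k * 1)).comp
        (mfderiv 𝓘(ℝ, E) 𝓘(ℝ, E) (fun x => k * x) (1 : G)) := by
    rw [h1]
    exact mfderiv_comp (I' := 𝓘(ℝ, E)) (1 : G) (hmd _ _) (hmd _ _)
  have h3 : ∀ k', k' = k →
      (mfderiv 𝓘(ℝ, E) 𝓘(ℝ, E) (fun x => g * x) k' : E →L[ℝ] E) =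
        (mfderiv 𝓘(ℝ, E) 𝓘(ℝ, E) (fun x => g * x) k : E →L[ℝ] E) := by
    rintro _ rfl
    rfl
  exact ((DFunLike.congr_fun h2 X).trans (DFunLike.congr_fun (h3 (k * 1) (mul_one k)) _)).symm

theorem isMIntegralCurve_mul_left {X : GroupLieAlgebra 𝓘(ℝ, E) G} {γ : ℝ → G}
    (hγ : IsMIntegralCurve (I := 𝓘(ℝ, E)) γ (mulInvariantVectorField X)) (g : G) :
    IsMIntegralCurve (I := 𝓘(ℝ, E)) (fun t => g * γ t) (mulInvariantVectorField X) := by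
  intro t
  have h1 : HasMFDerivAt 𝓘(ℝ, E) 𝓘(ℝ, E) (fun x => g * x) (γ t)
      (mfderiv 𝓘(ℝ, E) 𝓘(ℝ, E) (fun x => g * x) (γ t)) :=
    ((contMDiff_mul_left (I := 𝓘(ℝ, E)) (n := ∞)).contMDiffAt.mdifferentiableAt
      (by simp)).hasMFDerivAt
  have h2 := h1.comp t (hγ t)
  refine h2.congr_mfderiv (ContinuousLinearMap.ext fun r => ?_)
  let c : ℝ := r
  refine (map_smul (mfderiv 𝓘(ℝ, E) 𝓘(ℝ, E) (fun x => g * x) (γ t)) c _).trans ?_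
  exact congrArg (fun v : E => c • v) (mfderiv_mul_left_mulInvariantVectorField X g (γ t))

variable [FiniteDimensional ℝ E] [T2Space G]

theorem integralCurve_unique {X : GroupLieAlgebra 𝓘(ℝ, E) G} {γ γ' : ℝ → G}
    (hγ : IsMIntegralCurve (I := 𝓘(ℝ, E)) γ (mulInvariantVectorField X))
    (hγ' : IsMIntegralCurve (I := 𝓘(ℝ, E)) γ' (mulInvariantVectorField X)) (h0 : γ 0 = γ' 0) :
    γ = γ' := by
  have hC : CompleteSpace E := FiniteDimensional.complete ℝ E
  have h1 : LieGroup 𝓘(ℝ, E) 1 G := LieGroup.of_le (n := ∞) (by simp)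
  have h2 : IsManifold 𝓘(ℝ, E) 1 G := inferInstance
  refine isMIntegralCurve_Ioo_eq_of_contMDiff_boundaryless (t₀ := 0) ?_ hγ hγ' h0
  refine (contMDiff_mulInvariantVectorField X).of_le ?_
  rw [minSmoothness_of_isRCLikeNormedField]
  norm_num

theorem lieExp_eq {X : GroupLieAlgebra 𝓘(ℝ, E) G} {γ : ℝ → G}
    (hγ : IsMIntegralCurve (I := 𝓘(ℝ, E)) γ (mulInvariantVectorField X)) (h0 : γ 0 = 1) :
    lieExp X = γ 1 := by
  have hex : ∃ γ : ℝ → G, IsMIntegralCurve (I := 𝓘(ℝ, E)) γ (mulInvariantVectorField X) ∧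
      γ 0 = 1 := ⟨γ, hγ, h0⟩
  rw [lieExp, dif_pos hex,
    integralCurve_unique hex.choose_spec.1 hγ (hex.choose_spec.2.trans h0.symm)]

theorem lieExp_smul {X : GroupLieAlgebra 𝓘(ℝ, E) G} {γ : ℝ → G}
    (hγ : IsMIntegralCurve (I := 𝓘(ℝ, E)) γ (mulInvariantVectorField X)) (h0 : γ 0 = 1) (s : ℝ) :
    lieExp (s • X) = γ s := by
  have h1 := hγ.comp_mul s
  rw [← mulInvariantVectorField_smul] at h1
  rw [lieExp_eq h1 (by simp [h0])]
  simp

theorem lieExp_zero : lieExp (0 : GroupLieAlgebra 𝓘(ℝ, E) G) = 1 := by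
  refine lieExp_eq (γ := fun _ => 1) (isMIntegralCurve_const ?_) rfl
  exact mulInvariantVectorField_one 0

/-- If the exponential map is injective, then every left invariant vector field has a global
integral curve through the identity. -/
theorem exists_integralCurve
    (hinj : Function.Injective (lieExp : GroupLieAlgebra 𝓘(ℝ, E) G → G))
    (X : GroupLieAlgebra 𝓘(ℝ, E) G) : ∃ γ : ℝ → G,
      IsMIntegralCurve (I := 𝓘(ℝ, E)) γ (mulInvariantVectorField X) ∧ γ 0 = 1 := by
  by_contra hne
  -- Without an integral curve, `lieExp X` takes its default value `1 = lieExp 0`. Injectivity then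
  -- gives `X = 0`, for which the constant curve is integral.
  have h1 : lieExp X = 1 := by rw [lieExp, dif_neg hne]
  have h2 : X = 0 := hinj (h1.trans lieExp_zero.symm)
  refine hne ⟨fun _ => 1, isMIntegralCurve_const ?_, rfl⟩
  rw [h2]
  exact mulInvariantVectorField_one 0

/-- As functions of `t`, both `γ s * γ t` and `γ (s + t)` are integral curves of the same
left-invariant field starting at `γ s`. -/
theorem lieExp_add_smul
    (hinj : Function.Injective (lieExp : GroupLieAlgebra 𝓘(ℝ, E) G → G))
    (X : GroupLieAlgebra 𝓘(ℝ, E) G) (s t : ℝ) :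
    lieExp (s • X) * lieExp (t • X) = lieExp ((s + t) • X) := by
  obtain ⟨γ, hγ, h0⟩ := exists_integralCurve hinj X
  rw [lieExp_smul hγ h0, lieExp_smul hγ h0, lieExp_smul hγ h0]
  have h1 := integralCurve_unique (isMIntegralCurve_mul_left hγ (γ s)) (hγ.comp_add s)
    (by simp [h0])
  have h2 := congrFun h1 t
  simpa [add_comm] using h2

/-- The group law of `G` in exponential coordinates. -/
noncomputable def expLaw (Ψ : E ≃ₘ^∞⟮𝓘(ℝ, E), 𝓘(ℝ, E)⟯ G) (x y : E) : E := Ψ.symm (Ψ x * Ψ y)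

variable {Ψ : E ≃ₘ^∞⟮𝓘(ℝ, E), 𝓘(ℝ, E)⟯ G}

omit [LieGroup 𝓘(ℝ, E) ∞ G] [FiniteDimensional ℝ E] [T2Space G] in
theorem apply_expLaw (x y : E) : Ψ (expLaw Ψ x y) = Ψ x * Ψ y := Ψ.apply_symm_apply _

variable (hΨ : ∀ X : GroupLieAlgebra 𝓘(ℝ, E) G, Ψ X = lieExp X)

include hΨ

omit [LieGroup 𝓘(ℝ, E) ∞ G] [FiniteDimensional ℝ E] [T2Space G] in
theorem injective_lieExp : Function.Injective (lieExp : GroupLieAlgebra 𝓘(ℝ, E) G → G) := by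
  intro X Y hXY
  rw [← hΨ, ← hΨ] at hXY
  exact Ψ.injective hXY

theorem expGroupLaw_expLaw : ExpGroupLaw (expLaw Ψ) where
  contDiff := by
    have h1 : ContMDiff 𝓘(ℝ, E × E) 𝓘(ℝ, E) ∞ fun p : E × E => Ψ p.1 * Ψ p.2 :=
      (Ψ.contMDiff.comp contDiff_fst.contMDiff).mul (Ψ.contMDiff.comp contDiff_snd.contMDiff)
    exact (Ψ.symm.contMDiff.comp h1).contDiff
  assoc x y z := by
    refine Ψ.injective (?_ : Ψ _ = Ψ _)
    simp only [apply_expLaw, mul_assoc]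
  smul_smul X s t := by
    refine Ψ.injective (?_ : Ψ _ = Ψ _)
    rw [apply_expLaw]
    exact (congrArg₂ (· * ·) (hΨ (s • X)) (hΨ (t • X))).trans
      ((lieExp_add_smul (injective_lieExp hΨ) X s t).trans (hΨ ((s + t) • X)).symm)

end LieGroups
-- The Lie algebra of `G` in exponential coordinates.
section LieGroups

variable {E : Type*} [NormedAddCommGroup E] [NormedSpace ℝ E] [FiniteDimensional ℝ E]
  {G : Type*} [TopologicalSpace G] [T2Space G] [ChartedSpace E G] [Group G]
  [LieGroup 𝓘(ℝ, E) ∞ G]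
  {Ψ : E ≃ₘ^∞⟮𝓘(ℝ, E), 𝓘(ℝ, E)⟯ G} (hΨ : ∀ X : GroupLieAlgebra 𝓘(ℝ, E) G, Ψ X = lieExp X)

include hΨ

theorem apply_zero_eq_one : Ψ 0 = 1 := (hΨ 0).trans lieExp_zero

/-- The curve `t ↦ Ψ (t • X)` is the integral curve through `1`, so its velocity at `0` is `X`. -/
theorem mfderiv_exp_zero (X : E) :
    (mfderiv 𝓘(ℝ, E) 𝓘(ℝ, E) Ψ 0 : E →L[ℝ] E) X = X := by
  obtain ⟨γ, hγ, h0⟩ := exists_integralCurve (injective_lieExp hΨ) X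
  have h1 : γ = fun t : ℝ => Ψ (t • X) := by
    funext t
    exact ((hΨ (t • X)).trans (lieExp_smul hγ h0 t)).symm
  have h2 : HasMFDerivAt 𝓘(ℝ, E) 𝓘(ℝ, E) Ψ ((0 : ℝ) • X)
      (mfderiv 𝓘(ℝ, E) 𝓘(ℝ, E) Ψ ((0 : ℝ) • X)) :=
    (Ψ.contMDiff.mdifferentiableAt (by simp)).hasMFDerivAt
  have h3 : HasFDerivAt (fun t : ℝ => t • X) ((ContinuousLinearMap.id ℝ ℝ).smulRight X) 0 :=
    ((ContinuousLinearMap.id ℝ ℝ).smulRight X).hasFDerivAt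
  have h4 := HasMFDerivAt.comp (0 : ℝ) (f := fun t : ℝ => t • X) h2 h3.hasMFDerivAt
  have h5 := hγ 0
  rw [h1] at h5
  have h6 := DFunLike.congr_fun (hasMFDerivAt_unique h5 h4) (1 : ℝ)
  have h7 : ∀ g : G, g = 1 → (mulInvariantVectorField (I := 𝓘(ℝ, E)) (G := G) X g : E) = X := by
    rintro _ rfl
    exact mulInvariantVectorField_one X
  have h8 : ∀ z : E, z = 0 → (mfderiv 𝓘(ℝ, E) 𝓘(ℝ, E) Ψ z : E →L[ℝ] E) X =
      (mfderiv 𝓘(ℝ, E) 𝓘(ℝ, E) Ψ 0 : E →L[ℝ] E) X := by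
    rintro _ rfl
    rfl
  have h9 : (1 : ℝ) • (mulInvariantVectorField (I := 𝓘(ℝ, E)) (G := G) X (Ψ ((0 : ℝ) • X)) : E) =
      (mfderiv 𝓘(ℝ, E) 𝓘(ℝ, E) Ψ ((0 : ℝ) • X) : E →L[ℝ] E) ((1 : ℝ) • X) := h6
  rw [one_smul, one_smul, h8 _ (zero_smul ℝ X),
    h7 _ (by rw [zero_smul]; exact apply_zero_eq_one hΨ)] at h9
  exact h9.symm

/-- Differentiation of `Ψ (expLaw Ψ x y) = Ψ x * Ψ y` in `y` at `0`. -/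
theorem mfderiv_exp_leftFrame (x X : E) :
    (mfderiv 𝓘(ℝ, E) 𝓘(ℝ, E) Ψ x : E →L[ℝ] E) (leftFrame (expLaw Ψ) x X) =
      mulInvariantVectorField (I := 𝓘(ℝ, E)) (G := G) X (Ψ x) := by
  have h := expGroupLaw_expLaw hΨ
  have hΨd : ∀ z, HasMFDerivAt 𝓘(ℝ, E) 𝓘(ℝ, E) Ψ z (mfderiv 𝓘(ℝ, E) 𝓘(ℝ, E) Ψ z) := fun z =>
    (Ψ.contMDiff.mdifferentiableAt (by simp)).hasMFDerivAt
  have h1 := HasMFDerivAt.comp (0 : E) (f := fun y => expLaw Ψ x y) (hΨd _)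
    (h.hasFDerivAt_leftFrame x).hasMFDerivAt
  have h2 : HasMFDerivAt 𝓘(ℝ, E) 𝓘(ℝ, E) (fun k : G => Ψ x * k) (Ψ 0)
      (mfderiv 𝓘(ℝ, E) 𝓘(ℝ, E) (fun k : G => Ψ x * k) (Ψ 0)) :=
    ((contMDiff_mul_left (I := 𝓘(ℝ, E)) (n := ∞)).contMDiffAt.mdifferentiableAt
      (by simp)).hasMFDerivAt
  have h3 := HasMFDerivAt.comp (0 : E) h2 (hΨd 0)
  have h4 : (fun k : G => Ψ x * k) ∘ Ψ = Ψ ∘ fun y => expLaw Ψ x y :=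
    funext fun y => (apply_expLaw x y).symm
  rw [h4] at h3
  have h5 := DFunLike.congr_fun (hasMFDerivAt_unique h1 h3) X
  have h6 : ∀ z : E, z = x → (mfderiv 𝓘(ℝ, E) 𝓘(ℝ, E) Ψ z : E →L[ℝ] E) =
      (mfderiv 𝓘(ℝ, E) 𝓘(ℝ, E) Ψ x : E →L[ℝ] E) := by
    rintro _ rfl
    rfl
  have h7 : ∀ g : G, g = 1 →
      (mfderiv 𝓘(ℝ, E) 𝓘(ℝ, E) (fun k : G => Ψ x * k) g : E →L[ℝ] E) =
        (mfderiv 𝓘(ℝ, E) 𝓘(ℝ, E) (fun k : G => Ψ x * k) (1 : G) : E →L[ℝ] E) := by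
    rintro _ rfl
    rfl
  have h8 : (mfderiv 𝓘(ℝ, E) 𝓘(ℝ, E) Ψ (expLaw Ψ x 0) : E →L[ℝ] E)
      (leftFrame (expLaw Ψ) x X) =
      (mfderiv 𝓘(ℝ, E) 𝓘(ℝ, E) (fun k : G => Ψ x * k) (Ψ 0) : E →L[ℝ] E)
        ((mfderiv 𝓘(ℝ, E) 𝓘(ℝ, E) Ψ 0 : E →L[ℝ] E) X) := h5
  rw [h6 _ (h.zero_right x), h7 _ (apply_zero_eq_one hΨ), mfderiv_exp_zero hΨ] at h8
  exact h8

/-- The pullback of a left invariant vector field to exponential coordinates. -/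
theorem mpullback_mulInvariantVectorField_exp (X : E) (x : E) :
    VectorField.mpullback 𝓘(ℝ, E) 𝓘(ℝ, E) Ψ
      (mulInvariantVectorField (I := 𝓘(ℝ, E)) (G := G) X) x = leftFrame (expLaw Ψ) x X := by
  have h1 : (mfderiv 𝓘(ℝ, E) 𝓘(ℝ, E) Ψ x).IsInvertible :=
    ⟨Ψ.mfderivToContinuousLinearEquiv (by simp) x, rfl⟩
  rw [VectorField.mpullback_apply]
  have h2 := mfderiv_exp_leftFrame hΨ x X
  exact (h1.inverse_apply_eq).2 h2.symm

/-- The bracket of the Lie algebra is the differential of the adjoint representation. -/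
theorem adjointDeriv_expLaw (X Y : GroupLieAlgebra 𝓘(ℝ, E) G) :
    adjointDeriv (expLaw Ψ) X Y = (⁅X, Y⁆ : GroupLieAlgebra 𝓘(ℝ, E) G) := by
  have hC : CompleteSpace E := FiniteDimensional.complete ℝ E
  have h := expGroupLaw_expLaw hΨ
  -- Brackets commute with pullback along `Ψ`. At `0` this compares the frame applied to `⁅X, Y⁆`
  -- with the bracket of the frame fields, which `lieBracket_leftFrame` evaluates.
  have h1 := VectorField.mpullback_mlieBracket (I := 𝓘(ℝ, E)) (I' := 𝓘(ℝ, E)) (n := ∞)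
    (f := Ψ) (x₀ := (0 : E)) (V := mulInvariantVectorField X) (W := mulInvariantVectorField Y)
    (mdifferentiableAt_mulInvariantVectorField X) (mdifferentiableAt_mulInvariantVectorField Y)
    Ψ.contMDiff.contMDiffAt
    (by rw [minSmoothness_of_isRCLikeNormedField]; exact ENat.LEInfty.out)
  have h2 : ∀ Z : GroupLieAlgebra 𝓘(ℝ, E) G, VectorField.mpullback 𝓘(ℝ, E) 𝓘(ℝ, E) Ψ
      (mulInvariantVectorField Z) = fun x => leftFrame (expLaw Ψ) x Z :=
    fun Z => funext fun x => mpullback_mulInvariantVectorField_exp hΨ Z x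
  rw [← mulInvariantVector_mlieBracket, h2, h2, h2] at h1
  have h3 : ∀ V W : E → E, (VectorField.mlieBracket 𝓘(ℝ, E) V W 0 : E) =
      VectorField.lieBracket ℝ V W 0 := by
    intro V W
    have h4 := congrFun (VectorField.mlieBracketWithin_eq_lieBracketWithin (𝕜 := ℝ)
      (V := V) (W := W) (s := Set.univ)) 0
    have h5 : VectorField.mlieBracket 𝓘(ℝ, E) V W 0 =
        VectorField.mlieBracketWithin 𝓘(ℝ, E) V W Set.univ 0 :=
      (congrFun VectorField.mlieBracketWithin_univ 0).symm
    exact (h5.trans h4).trans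
      (congrFun (VectorField.lieBracketWithin_univ (𝕜 := ℝ) (E := E) (V := V) (W := W)) 0)
  have h5 : ∀ X Y Z : E, leftFrame (expLaw Ψ) 0 Z = VectorField.mlieBracket 𝓘(ℝ, E)
      (fun x => (leftFrame (expLaw Ψ) x : E →L[ℝ] E) X)
      (fun x => (leftFrame (expLaw Ψ) x : E →L[ℝ] E) Y) 0 → adjointDeriv (expLaw Ψ) X Y = Z := by
    intro X Y Z hZ
    have h6 := hZ.trans (h3 _ _)
    rw [h.lieBracket_leftFrame, h.leftFrame_zero] at h6
    exact h6.symm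
  exact h5 X Y _ h1

theorem exp_coordProd {d : ℕ} (b : Module.Basis (Fin d) ℝ E) (l : List (Fin d)) (z : E) :
    Ψ (coordProd (expLaw Ψ) b l z) =
      (l.map fun k => (lieExp (b.coord k z • b k : GroupLieAlgebra 𝓘(ℝ, E) G) : G)).prod := by
  induction l with
  | nil => exact apply_zero_eq_one hΨ
  | cons k l ih =>
    rw [coordProd, apply_expLaw, ih, List.map_cons, List.prod_cons]
    exact congrArg (· * _) (hΨ _)

end LieGroups

/-! ### Transport of differential operators and translations to coordinates. -/

section Operators

variable {E : Type*} [NormedAddCommGroup E] [NormedSpace ℝ E]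
  {M : Type*} [TopologicalSpace M] [ChartedSpace E M]
  {F : Type*} [NormedAddCommGroup F] [NormedSpace ℝ F]
  {N : Type*} [TopologicalSpace N] [ChartedSpace F N]

theorem pullbackOp_apply (Ψ : M ≃ₘ^∞⟮𝓘(ℝ, E), 𝓘(ℝ, F)⟯ N)
    (L : Module.End ℝ C^∞⟮𝓘(ℝ, F), N; ℝ⟯) (f : C^∞⟮𝓘(ℝ, E), M; ℝ⟯) (x : M) :
    pullbackOp Ψ L f x = L (f.comp Ψ.symm.toContMDiffMap) (Ψ x) := rfl

/-- Pullback is conjugation by an isomorphism of function algebras, so it respects commutators with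
multiplications and therefore preserves the order of operators. -/
theorem pullbackOp_commutator (Ψ : M ≃ₘ^∞⟮𝓘(ℝ, E), 𝓘(ℝ, F)⟯ N)
    (L : Module.End ℝ C^∞⟮𝓘(ℝ, F), N; ℝ⟯) (a : C^∞⟮𝓘(ℝ, E), M; ℝ⟯) :
    pullbackOp Ψ L * LinearMap.mulLeft ℝ a - LinearMap.mulLeft ℝ a * pullbackOp Ψ L =
      pullbackOp Ψ (L * LinearMap.mulLeft ℝ (a.comp Ψ.symm.toContMDiffMap) -
        LinearMap.mulLeft ℝ (a.comp Ψ.symm.toContMDiffMap) * L) := by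
  refine LinearMap.ext fun f => ?_
  ext x
  have h1 : a x = a (Ψ.symm (Ψ x)) := by rw [Ψ.symm_apply_apply]
  change L ((a * f).comp Ψ.symm.toContMDiffMap) (Ψ x) -
    a x * L (f.comp Ψ.symm.toContMDiffMap) (Ψ x) = L ((a * f).comp Ψ.symm.toContMDiffMap) (Ψ x) -
      a (Ψ.symm (Ψ x)) * L (f.comp Ψ.symm.toContMDiffMap) (Ψ x)
  rw [← h1]

theorem IsDiffOpOfOrderLE.pullbackOp (Ψ : M ≃ₘ^∞⟮𝓘(ℝ, E), 𝓘(ℝ, F)⟯ N) (k : ℕ) :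
    ∀ L : Module.End ℝ C^∞⟮𝓘(ℝ, F), N; ℝ⟯, IsDiffOpOfOrderLE k L →
      IsDiffOpOfOrderLE k (ExpSolvable.pullbackOp Ψ L) := by
  induction k with
  | zero =>
    intro L hL a
    rw [pullbackOp_commutator, hL]
    rfl
  | succ k ih =>
    intro L hL a
    rw [pullbackOp_commutator]
    exact ih _ (hL _)

theorem IsDiffOp.pullbackOp (Ψ : M ≃ₘ^∞⟮𝓘(ℝ, E), 𝓘(ℝ, F)⟯ N)
    {L : Module.End ℝ C^∞⟮𝓘(ℝ, F), N; ℝ⟯} (hL : IsDiffOp L) :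
    IsDiffOp (ExpSolvable.pullbackOp Ψ L) :=
  hL.imp fun k hk => IsDiffOpOfOrderLE.pullbackOp Ψ k L hk

variable {G : Type*} [TopologicalSpace G] [ChartedSpace E G] [Group G] [LieGroup 𝓘(ℝ, E) ∞ G]
  (Φ : E ≃ₘ^∞⟮𝓘(ℝ, E), 𝓘(ℝ, E)⟯ G)

/-- Left translation in the coordinates `Φ`. -/
noncomputable def leftShift (x : E) : C^∞⟮𝓘(ℝ, E), E; 𝓘(ℝ, E), E⟯ :=
  Φ.symm.toContMDiffMap.comp ((smoothLeftMul 𝓘(ℝ, E) (Φ x)).comp Φ.toContMDiffMap)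

/-- Right translation in the coordinates `Φ`. -/
noncomputable def rightShift (x : E) : C^∞⟮𝓘(ℝ, E), E; 𝓘(ℝ, E), E⟯ :=
  Φ.symm.toContMDiffMap.comp ((smoothRightMul 𝓘(ℝ, E) (Φ x)).comp Φ.toContMDiffMap)

theorem apply_leftShift (x y : E) : Φ (leftShift Φ x y) = Φ x * Φ y := Φ.apply_symm_apply _

theorem apply_rightShift (x y : E) : Φ (rightShift Φ x y) = Φ y * Φ x := Φ.apply_symm_apply _

variable {Φ}

/-- Invariance under left translation by `Φ x`, evaluated at the unit, moves the value at `x` to the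
origin. -/
theorem pullbackOp_apply_eq_leftShift (h0 : Φ 0 = 1) {L : Module.End ℝ C^∞⟮𝓘(ℝ, E), G; ℝ⟯}
    (hL : IsLeftInvariantDiffOp L) (f : C^∞⟮𝓘(ℝ, E), E; ℝ⟯) (x : E) :
    pullbackOp Φ L f x = pullbackOp Φ L (f.comp (leftShift Φ x)) 0 := by
  have h1 := congrArg (fun u : C^∞⟮𝓘(ℝ, E), G; ℝ⟯ => u 1)
    (hL.2 (Φ x) (f.comp Φ.symm.toContMDiffMap))
  have h2 : (f.comp Φ.symm.toContMDiffMap).comp (smoothLeftMul 𝓘(ℝ, E) (Φ x)) =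
      (f.comp (leftShift Φ x)).comp Φ.symm.toContMDiffMap := by
    ext g
    change f (Φ.symm (Φ x * g)) = f (Φ.symm (Φ x * Φ (Φ.symm g)))
    rw [Φ.apply_symm_apply]
  rw [pullbackOp_apply, pullbackOp_apply, ← h2, h0]
  refine Eq.trans ?_ h1.symm
  change L (f.comp Φ.symm.toContMDiffMap) (Φ x) = L (f.comp Φ.symm.toContMDiffMap) (Φ x * 1)
  rw [mul_one]

/-- Inversion turns right translation by `Φ x` into left translation by `(Φ x)⁻¹`, under which `L`
is invariant. -/
theorem pullbackOp_apply_eq_rightShift (h0 : Φ 0 = 1) {L : Module.End ℝ C^∞⟮𝓘(ℝ, E), G; ℝ⟯}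
    (hL : IsLeftInvariantDiffOp L) (f : C^∞⟮𝓘(ℝ, E), E; ℝ⟯) (x : E) :
    pullbackOp Φ (pushforwardOp (inversion E G) L) f x =
      pullbackOp Φ (pushforwardOp (inversion E G) L) (f.comp (rightShift Φ x)) 0 := by
  have h1 := congrArg (fun u : C^∞⟮𝓘(ℝ, E), G; ℝ⟯ => u 1)
    (hL.2 (Φ x)⁻¹ ((f.comp Φ.symm.toContMDiffMap).comp (inversion E G).toContMDiffMap))
  have h2 : ((f.comp Φ.symm.toContMDiffMap).comp (inversion E G).toContMDiffMap).comp
      (smoothLeftMul 𝓘(ℝ, E) (Φ x)⁻¹) = ((f.comp (rightShift Φ x)).comp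
        Φ.symm.toContMDiffMap).comp (inversion E G).toContMDiffMap := by
    ext g
    change f (Φ.symm ((Φ x)⁻¹ * g)⁻¹) = f (Φ.symm (Φ (Φ.symm g⁻¹) * Φ x))
    rw [Φ.apply_symm_apply, mul_inv_rev, inv_inv]
  change L ((f.comp Φ.symm.toContMDiffMap).comp (inversion E G).toContMDiffMap) (Φ x)⁻¹ =
    L (((f.comp (rightShift Φ x)).comp Φ.symm.toContMDiffMap).comp
      (inversion E G).toContMDiffMap) (Φ 0)⁻¹
  rw [← h2, h0, inv_one]
  refine Eq.trans ?_ h1.symm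
  change _ = L ((f.comp Φ.symm.toContMDiffMap).comp (inversion E G).toContMDiffMap) ((Φ x)⁻¹ * 1)
  rw [mul_one]

end Operators

end ExpSolvable

/-! ### The main theorem. -/

theorem proposition4p3
    {E : Type*} [NormedAddCommGroup E] [NormedSpace ℝ E] [FiniteDimensional ℝ E]
    {G : Type*} [TopologicalSpace G] [T2Space G] [ChartedSpace E G] [Group G]
    [LieGroup 𝓘(ℝ, E) ∞ G]
    (hG : ExpSolvable.IsExponentialSolvable E G)
    {n m : ℕ} (A : Fin n → GroupLieAlgebra 𝓘(ℝ, E) G) (N : Fin m → GroupLieAlgebra 𝓘(ℝ, E) G)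
    (hA : ExpSolvable.IsCoexponentialBasis A) (hN : ExpSolvable.IsMalcevBasis N) :
    ∃ Φ : E ≃ₘ^∞⟮𝓘(ℝ, E), 𝓘(ℝ, E)⟯ G,
      (∀ (t : Fin n → ℝ) (s : Fin m → ℝ),
        Φ ((∑ i, t i • A i) + ∑ j, s j • N j) =
          ExpSolvable.expProd A t * ExpSolvable.expProd N s) ∧
      ∀ L : Module.End ℝ C^∞⟮𝓘(ℝ, E), G; ℝ⟯, ExpSolvable.IsLeftInvariantDiffOp L →
        (ExpSolvable.pullbackOp Φ L ∈ ExpSolvable.expDiffOps E ∧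
          ExpSolvable.HasExpCoeffs (ExpSolvable.pullbackOp Φ L)) ∧
        (ExpSolvable.pullbackOp Φ (ExpSolvable.pushforwardOp (ExpSolvable.inversion E G) L) ∈
            ExpSolvable.expDiffOps E ∧
          ExpSolvable.HasExpCoeffs
            (ExpSolvable.pullbackOp Φ
              (ExpSolvable.pushforwardOp (ExpSolvable.inversion E G) L))) := by
  open ExpSolvable in
  have hsolv : LieAlgebra.IsSolvable (GroupLieAlgebra 𝓘(ℝ, E) G) := hG.solvable
  obtain ⟨Ψ, hΨ⟩ := hG.exp_diffeo
  have h := expGroupLaw_expLaw hΨ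
  have hfd : FiniteDimensional ℝ (GroupLieAlgebra 𝓘(ℝ, E) G) := ‹FiniteDimensional ℝ E›
  have hli : LinearIndependent ℝ (Fin.append A N) := by
    have h1 := hA.linearIndependent.sum_type hN.linearIndependent
      (by rw [hN.span_eq]; exact hA.isCompl.disjoint)
    have h2 := (linearIndependent_equiv finSumFinEquiv (f := Fin.append A N) (R := ℝ)).1
    refine h2 ?_
    convert! h1 using 1
    funext k
    rcases k with k | k
    · exact Fin.append_left A N k
    · exact Fin.append_right A N k
  have hspan : ⊤ ≤ Submodule.span ℝ (Set.range (Fin.append A N)) := by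
    rw [← hA.isCompl.sup_eq_top, ← hN.span_eq, sup_le_iff, Submodule.span_le, Submodule.span_le]
    constructor
    · rintro _ ⟨k, rfl⟩
      exact Submodule.subset_span ⟨Fin.castAdd m k, Fin.append_left A N k⟩
    · rintro _ ⟨k, rfl⟩
      exact Submodule.subset_span ⟨Fin.natAdd n k, Fin.append_right A N k⟩
  let b : Module.Basis (Fin (n + m)) ℝ E := Module.Basis.mk (M := E) hli hspan
  have hbapp : ⇑b = Fin.append A N := Module.Basis.coe_mk hli hspan
  have hb : ∀ i, ∀ X ∈ tailSpan b i, ∀ Y ∈ tailSpan b i,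
      adjointDeriv (expLaw Ψ) X Y ∈ tailSpan b (i + 1) := by
    intro i X hX Y hY
    rw [hbapp] at hX hY ⊢
    have h1 := lie_mem_tailSpan_succ A N hN.span_eq hN.lie_mem i X hX Y hY
    have h2 := adjointDeriv_expLaw hΨ X Y
    exact Set.mem_of_eq_of_mem h2 h1
  obtain ⟨Φ₀, hΦ₀⟩ := h.exists_diffeomorph_coordProd b hb
  -- `Φ₀` is the ordered product written in exponential coordinates; composing with the exponential
  -- map brings it to `G`.
  let Φ : E ≃ₘ^∞⟮𝓘(ℝ, E), 𝓘(ℝ, E)⟯ G := Φ₀.trans Ψ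
  have hΦ : ∀ z, Φ z = Ψ (Φ₀ z) := fun z => rfl
  have h0 : Φ 0 = 1 := by
    rw [hΦ, hΦ₀, h.coordProd_zero]
    exact apply_zero_eq_one hΨ
  refine ⟨Φ, fun t s => ?_, fun L hL => ?_⟩
  · have hz : ∀ k, b.coord k ((∑ i, t i • A i) + ∑ j, s j • N j) = Fin.append t s k := by
      have h1 : ((∑ i, t i • A i) + ∑ j, s j • N j : E) = ∑ k, Fin.append t s k • b k := by
        rw [hbapp, Fin.sum_univ_add]
        simp
        rfl
      intro k
      refine (congrArg (b.coord k) h1).trans ?_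
      rw [ Module.Basis.coord_apply, Module.Basis.repr_sum_self]
    have key : ∀ z : E, (∀ k, b.coord k z = Fin.append t s k) →
        Φ z = expProd A t * expProd N s := by
      intro z hz
      rw [hΦ, hΦ₀, exp_coordProd hΨ]
      simp only [hz]
      rw [← List.ofFn_eq_map, List.ofFn_add, List.prod_append, hbapp, expProd, expProd]
      simp
      rfl
    exact key _ hz
  · have hleft : pullbackOp Φ L ∈ expDiffOps E := by
      refine h.mem_expDiffOps_of_left_invariant b hb hΦ₀ (IsDiffOp.pullbackOp Φ hL.1)
        (m := leftShift Φ) (pullbackOp_apply_eq_leftShift h0 hL) fun x y => ?_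
      -- The relation between shifts and `expLaw Ψ` is checked in `G`, where both sides are the
      -- product of `Φ x` and `Φ y`.
      refine Ψ.injective (?_ : Ψ _ = Ψ _)
      rw [apply_expLaw]
      exact apply_leftShift Φ x y
    have hright : pullbackOp Φ (pushforwardOp (inversion E G) L) ∈ expDiffOps E := by
      refine h.mem_expDiffOps_of_right_invariant b hb hΦ₀
        (IsDiffOp.pullbackOp Φ (IsDiffOp.pullbackOp _ hL.1))
        (m := rightShift Φ) (pullbackOp_apply_eq_rightShift h0 hL) fun x y => ?_
      refine Ψ.injective (?_ : Ψ _ = Ψ _)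
      rw [apply_expLaw]
      exact apply_rightShift Φ x y
    exact ⟨⟨hleft, HasExpCoeffs.of_mem_expDiffOps hleft⟩,
      ⟨hright, HasExpCoeffs.of_mem_expDiffOps hright⟩⟩
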